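/- Throughout, sequence spaces are real and $\mathbb N=\{1,2,\dots\}$; $c_{00}$ is the space of finitely supported sequences with unit vectors $(e_n)_{n\ge1}$, and $\langle x,f\rangle=\sum_n x_nf_n$. For finite sets $A,B\subset\mathbb N$ write $A<B$ if $a<b$ for all $a\in A$, $b\in B$. **Schreier families.** $\mathcal F_0=\{\emptyset\}\cup\{\{n\}:n\in\mathbb N\}$, and $\mathcal F_{k+1}$ consists of $\emptyset$ and all unions $A_1\cup\dots\cup A_d$ with $d\ge1$, $A_i\in\mathcal F_k$, all elements of the $A_i$ at least $d$, and $A_i<A_j$ for $i<j$. A finite sequence $(E_1,\dots,E_d)$ of non-empty finite subsets of $\mathbb N$ is *$\mathcal F_k$-admissible* (resp. *$\mathcal F_k$-allowable*) if $\{\min E_1,\dots,\min E_d\}\in\mathcal F_k$ and $E_1<\dots<E_d$ (resp. the $E_i$ are pairwise disjoint). **The spaces.** A sequence $(\theta_n)_{n\ge1}$ is *regular* if $\theta_n\in(0,1)$ for all $n$, $(\theta_n)$ is decreasing (not necessarily strictly) with limit $0$, and $\theta_{n+m}\ge\theta_n\theta_m$ for all $n,m$. For such a sequence let $K\subset c_{00}$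 be the smallest set that contains all $\pm e_n$ and contains $\theta_k(f_1+\dots+f_d)$ whenever $k,d\ge1$, $f_1,\dots,f_d\in K$ and $(\operatorname{supp}f_1,\dots,\operatorname{supp}f_d)$ is $\mathcal F_k$-allowable; $T_M[(\mathcal F_k,\theta_k)_{k=1}^\infty]$ is the completion of $c_{00}$ under the norm $\|x\|=\sup_{f\in K}\langle x,f\rangle$. For $m\ge1$, the space $T_{M(m)}[(\mathcal F_k,\theta_k)_{k=1}^\infty]$ is defined in the same way, except that for $k>m$ "allowable" is replaced by "admissible". For $0<\delta<1$, the Tsirelson space $T_\delta$ is defined in the same way from the smallest set that contains all $\pm e_n$ and contains $\delta(f_1+\dots+f_d)$ whenever $d\ge1$, $f_1,\dots,f_d$ belong to the set and $(\operatorname{supp}f_1,\dots,\operatorname{supp}f_d)$ is $\mathcal F_1$-admissible. (Equivalently, the norm of $T_\delta$ is determined by $\|x\|=\max\{\|x\|_\infty,\ \delta\sup\sum_{i=1}^d\|E_ix\|\}$, the supremum over all $d$ and $d\le E_1<\dots<E_d$.) The *2-convexification* $X^{(2)}$ of such a space $X$ is the completion of $c_{00}$ under $\|x\|_{(2)}=\big\|\sum_n|x_n|^2e_n\big\|_X^{1/2}$.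 Two Banach spaces $X,Y$ are *totally incomparable* if no infinite-dimensional closed subspace of $X$ is linearly homeomorphic to a closed subspace of $Y$. **Proposition.** Let $0<\delta<1$ and let $(\theta_n)_{n\ge1}$ be a regular sequence with $\lim_n\theta_n^{1/n}=1$. Let $X=T_M[(\mathcal F_k,\theta_k)_{k=1}^\infty]$, or $X=T_{M(m)}[(\mathcal F_k,\theta_k)_{k=1}^\infty]$ for some $m\ge1$. Then $X$ and $T_\delta$ are totally incomparable. Moreover, $X^{(2)}$ and $T_\delta^{(2)}$ are totally incomparable. -/

import Mathlib

open Filter Topology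

noncomputable section

namespace MixedTsirelson

/-- `c₀₀`: the finitely supported real sequences, indexed by the positive integers. -/
abbrev C00 : Type := ℕ+ →₀ ℝ

/-! ### Schreier families, admissible and allowable sequences of sets -/

/-- `E₁ < E₂ < ⋯ < E_d` for finite sets of positive integers. -/
def Successive {d : ℕ} (E : Fin d → Finset ℕ+) : Prop :=
  ∀ i j : Fin d, i < j → ∀ a ∈ E i, ∀ b ∈ E j, a < b

/-- The Schreier families `F_n` of finite order: `F_0` consists of the empty set and the
singletons, and `F_{n+1}` of the unions `A₁ ∪ ⋯ ∪ A_d` with `A_i ∈ F_n` and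
`d ≤ A₁ < ⋯ < A_d`. (For `d = 0` the union is the empty set.) -/
def schreier : ℕ → Set (Finset ℕ+)
  | 0 => {A | A = ∅ ∨ ∃ n, A = {n}}
  | k + 1 => {A | ∃ (d : ℕ) (B : Fin d → Finset ℕ+), (∀ i, B i ∈ schreier k) ∧
      (∀ i, ∀ a ∈ B i, d ≤ (a : ℕ)) ∧ Successive B ∧ A = Finset.univ.biUnion B}

/-- `{min E₁, …, min E_d} ∈ M`; in particular all the `E_i` are nonempty. -/
def MinimaMem (M : Set (Finset ℕ+)) {d : ℕ} (E : Fin d → Finset ℕ+) : Prop :=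
  ∃ m : Fin d → ℕ+, (∀ i, IsLeast (E i : Set ℕ+) (m i)) ∧ Finset.univ.image m ∈ M

/-- `M`-admissible sequences of finite sets: successive, with set of minima in `M`. -/
def Admissible (M : Set (Finset ℕ+)) {d : ℕ} (E : Fin d → Finset ℕ+) : Prop :=
  Successive E ∧ MinimaMem M E

/-- `M`-allowable sequences of finite sets: pairwise disjoint, with set of minima in `M`. -/
def Allowable (M : Set (Finset ℕ+)) {d : ℕ} (E : Fin d → Finset ℕ+) : Prop :=
  Pairwise (fun i j => Disjoint (E i) (E j)) ∧ MinimaMem M E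

lemma Successive.disjoint {d : ℕ} {E : Fin d → Finset ℕ+} (h : Successive E) :
    Pairwise (fun i j => Disjoint (E i) (E j)) := by
  intro i j hij
  rw [Finset.disjoint_left]
  intro a hi hj
  rcases lt_or_gt_of_ne hij with h' | h'
  · exact lt_irrefl _ (h i j h' a hi a hj)
  · exact lt_irrefl _ (h j i h' a hj a hi)

/-! ### Norming sets -/

/-- The smallest set `K ⊆ c₀₀` that contains all `± e_n` and contains `θ_i (f₁ + ⋯ + f_d)`
whenever `f₁, …, f_d ∈ K` (`d ≥ 1`) and the sequence `(supp f₁, …, supp f_d)` is of the kind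
`P i`. -/
inductive Generated {ι : Type} (θ : ι → ℝ)
    (P : ι → ∀ d : ℕ, (Fin d → Finset ℕ+) → Prop) : C00 → Prop
  | pos (n : ℕ+) : Generated θ P (Finsupp.single n 1)
  | neg (n : ℕ+) : Generated θ P (-Finsupp.single n 1)
  | sum (i : ι) (d : ℕ) (hd : 0 < d) (f : Fin d → C00) (hf : ∀ j, Generated θ P (f j))
      (hP : P i d (fun j => (f j).support)) : Generated θ P (θ i • ∑ j, f j)

/-- A set of functionals on `c₀₀` that contains the coordinate functionals, lies in the unit
ball of `ℓ_∞`, and is invariant under changes of signs of the coordinates. -/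
structure NormingSet where
  carrier : Set C00
  single_mem : ∀ n, Finsupp.single n 1 ∈ carrier
  abs_le_one : ∀ f ∈ carrier, ∀ n, |f n| ≤ 1
  sign_mem : ∀ f ∈ carrier, ∀ s : ℕ+ → ℝ, (∀ n, s n = 1 ∨ s n = -1) →
    ∃ g ∈ carrier, ∀ n, g n = s n * f n

lemma Generated.abs_le_one {ι : Type} {θ : ι → ℝ} (hθ : ∀ i, 0 < θ i ∧ θ i < 1)
    {P : ι → ∀ d : ℕ, (Fin d → Finset ℕ+) → Prop}
    (hP : ∀ i d E, P i d E → Pairwise (fun j k => Disjoint (E j) (E k)))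
    {f : C00} (hf : Generated θ P f) (n : ℕ+) : |f n| ≤ 1 := by
  induction hf with
  | pos m =>
    rw [Finsupp.single_apply]; split_ifs <;> simp
  | neg m =>
    rw [Finsupp.neg_apply, Finsupp.single_apply]; split_ifs <;> simp
  | sum i d hd f hf hE ih =>
    have key : |∑ j, f j n| ≤ 1 := by
      by_cases h : ∃ j, f j n ≠ 0
      · obtain ⟨j, hj⟩ := h
        rw [Finset.sum_eq_single j]
        · exact ih j
        · intro k _ hk
          by_contra hk'
          exact Finset.disjoint_left.1 (hP i d _ hE hk)
            (Finsupp.mem_support_iff.2 hk') (Finsupp.mem_support_iff.2 hj)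
        · simp
      · push Not at h
        simp [h]
    rw [Finsupp.smul_apply, Finsupp.finsetSum_apply, smul_eq_mul, abs_mul,
      abs_of_pos (hθ i).1]
    nlinarith [(hθ i).1, (hθ i).2, abs_nonneg (∑ j, f j n)]

lemma Generated.sign_mem {ι : Type} {θ : ι → ℝ}
    {P : ι → ∀ d : ℕ, (Fin d → Finset ℕ+) → Prop}
    {f : C00} (hf : Generated θ P f) (s : ℕ+ → ℝ) (hs : ∀ n, s n = 1 ∨ s n = -1) :
    ∃ g, Generated θ P g ∧ ∀ n, g n = s n * f n := by
  induction hf with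
  | pos m =>
    rcases hs m with h | h
    · refine ⟨_, .pos m, fun n => ?_⟩
      rw [Finsupp.single_apply]; split_ifs with h'
      · simp [← h', h]
      · simp
    · refine ⟨_, .neg m, fun n => ?_⟩
      rw [Finsupp.neg_apply, Finsupp.single_apply]; split_ifs with h'
      · simp [← h', h]
      · simp
  | neg m =>
    rcases hs m with h | h
    · refine ⟨_, .neg m, fun n => ?_⟩
      rw [Finsupp.neg_apply, Finsupp.single_apply]; split_ifs with h'
      · simp [← h', h]
      · simp
    · refine ⟨_, .pos m, fun n => ?_⟩
      rw [Finsupp.neg_apply, Finsupp.single_apply]; split_ifs with h'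
      · simp [← h', h]
      · simp
  | sum i d hd f hf hE ih =>
    choose g hg hgs using ih
    have hsupp : (fun j => (g j).support) = fun j => (f j).support := by
      funext j
      ext n
      rw [Finsupp.mem_support_iff, Finsupp.mem_support_iff, hgs j n]
      rcases hs n with h | h <;> simp [h]
    refine ⟨_, .sum i d hd g hg (hsupp ▸ hE), fun n => ?_⟩
    simp only [Finsupp.smul_apply, Finsupp.finsetSum_apply, smul_eq_mul, hgs]
    rw [← Finset.mul_sum]; ring

/-- The norming set `K` generated by `(θ_i)` and `(P_i)`. -/
def generatedSet {ι : Type} (θ : ι → ℝ) (hθ : ∀ i, 0 < θ i ∧ θ i < 1)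
    (P : ι → ∀ d : ℕ, (Fin d → Finset ℕ+) → Prop)
    (hP : ∀ i d E, P i d E → Pairwise (fun j k => Disjoint (E j) (E k))) : NormingSet where
  carrier := {f | Generated θ P f}
  single_mem := .pos
  abs_le_one _ hf n := Generated.abs_le_one hθ hP hf n
  sign_mem _ hf s hs := Generated.sign_mem hf s hs

/-! ### The norm of a norming set and its 2-convexification -/

/-- `‖x‖ = sup {⟨x, f⟩ : f ∈ K}`. -/
def NormingSet.norm (K : NormingSet) (x : C00) : ℝ :=
  ⨆ f : K.carrier, Finsupp.linearCombination ℝ (⇑(f : C00)) x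

/-- The coordinatewise square of a sequence. -/
def sq (x : C00) : C00 := x.mapRange (fun t => t ^ 2) (by simp)

/-- The norm of the 2-convexification: `‖x‖₂ = ‖Σ |x_n|² e_n‖^{1/2}`. -/
def NormingSet.norm2 (K : NormingSet) (x : C00) : ℝ := √(K.norm (sq x))

namespace NormingSet

variable (K : NormingSet)

lemma pairing_eq {f x : C00} {s : Finset ℕ+} (h : x.support ⊆ s) :
    Finsupp.linearCombination ℝ (⇑f) x = ∑ n ∈ s, x n * f n := by
  rw [Finsupp.linearCombination_apply, Finsupp.sum_of_support_subset _ h _ (by simp)]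
  simp

lemma bddAbove (x : C00) :
    BddAbove (Set.range fun f : K.carrier => Finsupp.linearCombination ℝ (⇑(f : C00)) x) := by
  refine ⟨∑ n ∈ x.support, |x n|, ?_⟩
  rintro _ ⟨f, rfl⟩
  simp only
  rw [pairing_eq subset_rfl]
  refine Finset.sum_le_sum fun n _ => (le_abs_self _).trans ?_
  rw [abs_mul]
  exact mul_le_of_le_one_right (abs_nonneg _) (K.abs_le_one f f.2 n)

lemma pairing_le {f : C00} (hf : f ∈ K.carrier) (x : C00) :
    Finsupp.linearCombination ℝ (⇑f) x ≤ K.norm x :=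
  le_ciSup (K.bddAbove x) (⟨f, hf⟩ : K.carrier)

instance : Nonempty K.carrier := ⟨⟨_, K.single_mem 1⟩⟩

lemma norm_le {x : C00} {c : ℝ}
    (h : ∀ f ∈ K.carrier, Finsupp.linearCombination ℝ (⇑f) x ≤ c) : K.norm x ≤ c :=
  ciSup_le fun f => h f f.2

lemma neg_pairing_le {f : C00} (hf : f ∈ K.carrier) (x : C00) :
    -Finsupp.linearCombination ℝ (⇑f) x ≤ K.norm x := by
  obtain ⟨g, hg, h⟩ := K.sign_mem f hf (fun _ => -1) (fun _ => Or.inr rfl)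
  refine le_trans (le_of_eq ?_) (K.pairing_le hg x)
  rw [pairing_eq subset_rfl, pairing_eq subset_rfl]
  simp [h]

lemma abs_pairing_le {f : C00} (hf : f ∈ K.carrier) (x : C00) :
    |Finsupp.linearCombination ℝ (⇑f) x| ≤ K.norm x :=
  abs_le'.2 ⟨K.pairing_le hf x, K.neg_pairing_le hf x⟩

lemma abs_apply_le (x : C00) (n : ℕ+) : |x n| ≤ K.norm x := by
  have h : Finsupp.linearCombination ℝ (⇑(Finsupp.single n (1 : ℝ))) x = x n := by
    rw [pairing_eq (s := insert n x.support) (Finset.subset_insert _ _),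
      Finset.sum_eq_single n]
    · simp
    · intro m _ hm; simp [hm.symm]
    · simp
  exact h ▸ K.abs_pairing_le (K.single_mem n) x

lemma norm_nonneg (x : C00) : 0 ≤ K.norm x := (abs_nonneg _).trans (K.abs_apply_le x 1)

lemma eq_zero {x : C00} (h : K.norm x = 0) : x = 0 := by
  ext n
  have := K.abs_apply_le x n
  rw [h] at this
  simpa using this

lemma norm_add_le (x y : C00) : K.norm (x + y) ≤ K.norm x + K.norm y := by
  refine K.norm_le fun f hf => ?_
  rw [map_add]
  exact add_le_add (K.pairing_le hf x) (K.pairing_le hf y)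

lemma norm_smul_le (c : ℝ) (x : C00) : K.norm (c • x) ≤ |c| * K.norm x := by
  refine K.norm_le fun f hf => ?_
  rw [map_smul, smul_eq_mul]
  refine (le_abs_self _).trans ?_
  rw [abs_mul]
  exact mul_le_mul_of_nonneg_left (K.abs_pairing_le hf x) (abs_nonneg c)

lemma norm_smul (c : ℝ) (x : C00) : K.norm (c • x) = |c| * K.norm x := by
  refine le_antisymm (K.norm_smul_le c x) ?_
  rcases eq_or_ne c 0 with rfl | hc
  · simpa using K.norm_nonneg _
  · have := K.norm_smul_le c⁻¹ (c • x)
    rw [smul_smul, inv_mul_cancel₀ hc, one_smul, abs_inv] at this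
    have hc' : 0 < |c| := abs_pos.2 hc
    rwa [inv_mul_eq_div, le_div_iff₀ hc', mul_comm] at this

lemma exists_abs {f : C00} (hf : f ∈ K.carrier) : ∃ g ∈ K.carrier, ∀ n, g n = |f n| := by
  obtain ⟨g, hg, h⟩ := K.sign_mem f hf (fun n => if 0 ≤ f n then 1 else -1)
    (fun n => by by_cases hn : 0 ≤ f n <;> simp [hn])
  refine ⟨g, hg, fun n => ?_⟩
  rw [h]
  split_ifs with hn
  · simp [abs_of_nonneg hn]
  · simp [abs_of_neg (not_le.1 hn)]

lemma sq_apply (x : C00) (n : ℕ+) : sq x n = x n ^ 2 := by simp [sq]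

lemma sq_support (x : C00) : (sq x).support ⊆ x.support := Finsupp.support_mapRange

lemma norm2_add_le (x y : C00) : K.norm2 (x + y) ≤ K.norm2 x + K.norm2 y := by
  have hx0 := K.norm_nonneg (sq x)
  have hy0 := K.norm_nonneg (sq y)
  refine Real.sqrt_le_iff.2 ⟨add_nonneg (Real.sqrt_nonneg _) (Real.sqrt_nonneg _), ?_⟩
  refine K.norm_le fun f hf => ?_
  obtain ⟨g, hg, hgf⟩ := K.exists_abs hf
  set s := x.support ∪ y.support with hs
  have e1 := K.pairing_le hg (sq x)
  have e2 := K.pairing_le hg (sq y)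
  rw [pairing_eq ((sq_support x).trans (Finset.subset_union_left : _ ⊆ s))] at e1
  rw [pairing_eq ((sq_support y).trans (Finset.subset_union_right : _ ⊆ s))] at e2
  rw [pairing_eq ((sq_support (x + y)).trans (Finsupp.support_add : _ ⊆ s))]
  have hg0 : ∀ n, 0 ≤ g n := fun n => hgf n ▸ abs_nonneg _
  have cs := Real.sum_mul_le_sqrt_mul_sqrt s (fun n => √(g n) * x n) (fun n => √(g n) * y n)
  have r1 : ∀ z : C00, ∑ n ∈ s, (√(g n) * z n) ^ 2 = ∑ n ∈ s, sq z n * g n := fun z =>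
    Finset.sum_congr rfl fun n _ => by rw [mul_pow, Real.sq_sqrt (hg0 n), sq_apply]; ring
  have r2 : ∑ n ∈ s, √(g n) * x n * (√(g n) * y n) = ∑ n ∈ s, x n * y n * g n :=
    Finset.sum_congr rfl fun n _ => by
      have := Real.mul_self_sqrt (hg0 n)
      linear_combination (x n * y n) * this
  rw [r1, r1, r2] at cs
  have cs' : ∑ n ∈ s, x n * y n * g n ≤ K.norm2 x * K.norm2 y :=
    cs.trans (mul_le_mul (Real.sqrt_le_sqrt e1) (Real.sqrt_le_sqrt e2)
      (Real.sqrt_nonneg _) (Real.sqrt_nonneg _))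
  have r3 : ∑ n ∈ s, sq (x + y) n * f n ≤ ∑ n ∈ s, sq (x + y) n * g n :=
    Finset.sum_le_sum fun n _ => mul_le_mul_of_nonneg_left (hgf n ▸ le_abs_self _)
      (by rw [sq_apply]; positivity)
  have r4 : ∑ n ∈ s, sq (x + y) n * g n = ∑ n ∈ s, sq x n * g n
      + 2 * ∑ n ∈ s, x n * y n * g n + ∑ n ∈ s, sq y n * g n := by
    rw [Finset.mul_sum, ← Finset.sum_add_distrib, ← Finset.sum_add_distrib]
    refine Finset.sum_congr rfl fun n _ => ?_
    simp only [sq_apply, Finsupp.add_apply]; ring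
  have q1 : K.norm2 x ^ 2 = K.norm (sq x) := Real.sq_sqrt hx0
  have q2 : K.norm2 y ^ 2 = K.norm (sq y) := Real.sq_sqrt hy0
  nlinarith

lemma norm2_smul (c : ℝ) (x : C00) : K.norm2 (c • x) = |c| * K.norm2 x := by
  have h : sq (c • x) = c ^ 2 • sq x := by
    ext n; simp [sq_apply, mul_pow]
  rw [norm2, h, K.norm_smul, abs_of_nonneg (sq_nonneg c), Real.sqrt_mul (sq_nonneg c),
    Real.sqrt_sq_eq_abs, norm2]

lemma norm2_eq_zero {x : C00} (h : K.norm2 x = 0) : x = 0 := by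
  have h1 := K.eq_zero ((Real.sqrt_eq_zero (K.norm_nonneg _)).1 h)
  ext n
  have h2 : sq x n = 0 := by rw [h1]; rfl
  rw [sq_apply] at h2
  simpa using h2

/-! ### The Banach spaces -/

/-- `c₀₀`, to be equipped with the norm given by `K`. -/
def Pre (_K : NormingSet) : Type := C00

instance : AddCommGroup K.Pre := inferInstanceAs (AddCommGroup C00)
instance : Module ℝ K.Pre := inferInstanceAs (Module ℝ C00)
instance : Norm K.Pre := ⟨K.norm⟩

lemma preCore : NormedSpace.Core ℝ K.Pre where
  norm_nonneg := K.norm_nonneg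
  norm_smul := K.norm_smul
  norm_triangle := K.norm_add_le
  norm_eq_zero_iff x := ⟨K.eq_zero, fun h => by
    subst h
    have h0 := K.norm_smul 0 0
    rw [zero_smul, abs_zero, zero_mul] at h0
    exact h0⟩

instance : NormedAddCommGroup K.Pre := NormedAddCommGroup.ofCore K.preCore
instance : NormedSpace ℝ K.Pre := NormedSpace.ofCore K.preCore

/-- The Banach space of a norming set: the completion of `(c₀₀, ‖·‖)`. -/
abbrev Space : Type := UniformSpace.Completion K.Pre

/-- `c₀₀`, to be equipped with the 2-convexified norm given by `K`. -/
def Pre2 (_K : NormingSet) : Type := C00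

instance : AddCommGroup K.Pre2 := inferInstanceAs (AddCommGroup C00)
instance : Module ℝ K.Pre2 := inferInstanceAs (Module ℝ C00)
instance : Norm K.Pre2 := ⟨K.norm2⟩

lemma pre2Core : NormedSpace.Core ℝ K.Pre2 where
  norm_nonneg _ := Real.sqrt_nonneg _
  norm_smul := K.norm2_smul
  norm_triangle := K.norm2_add_le
  norm_eq_zero_iff x := ⟨K.norm2_eq_zero, fun h => by
    subst h
    have h0 := K.norm2_smul 0 0
    rw [zero_smul, abs_zero, zero_mul] at h0
    exact h0⟩

instance : NormedAddCommGroup K.Pre2 := NormedAddCommGroup.ofCore K.pre2Core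
instance : NormedSpace ℝ K.Pre2 := NormedSpace.ofCore K.pre2Core

/-- The 2-convexification of `K.Space`: the completion of `c₀₀` under `‖Σ |x_n|² e_n‖^{1/2}`. -/
abbrev Space2 : Type := UniformSpace.Completion K.Pre2

end NormingSet

/-! ### The concrete spaces -/

/-- Regular sequences: `θ_n ∈ (0,1)`, `θ_n` decreases to `0`, and `θ_{n+m} ≥ θ_n θ_m`. -/
structure Regular (θ : ℕ+ → ℝ) : Prop where
  mem : ∀ n, 0 < θ n ∧ θ n < 1
  antitone : Antitone θ
  tendsto : Tendsto θ atTop (𝓝 0)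
  mul_le : ∀ n m, θ n * θ m ≤ θ (n + m)

/-- The norming set of the Tsirelson space `T_δ = T[(F_1, δ)]`. -/
def tsirelson (δ : ℝ) (h0 : 0 < δ) (h1 : δ < 1) : NormingSet :=
  generatedSet (ι := Unit) (fun _ => δ) (fun _ => ⟨h0, h1⟩)
    (fun _ _ E => Admissible (schreier 1) E) (fun _ _ _ h => h.1.disjoint)

/-- The norming set of the modified mixed Tsirelson space `T_M[(F_k, θ_k)_{k ≥ 1}]`. -/
def modified (θ : ℕ+ → ℝ) (hθ : Regular θ) : NormingSet :=
  generatedSet θ hθ.mem (fun k _ E => Allowable (schreier k) E) (fun _ _ _ h => h.1)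

/-- The norming set of the boundedly modified mixed Tsirelson space
`T_{M(m)}[(F_k, θ_k)_{k ≥ 1}]`: allowable sequences for `k ≤ m`, admissible ones for `k > m`. -/
def boundedlyModified (m : ℕ+) (θ : ℕ+ → ℝ) (hθ : Regular θ) : NormingSet :=
  generatedSet θ hθ.mem
    (fun k _ E => (k ≤ m ∧ Allowable (schreier k) E) ∨ (m < k ∧ Admissible (schreier k) E))
    (fun _ _ _ h => h.elim (fun h => h.2.1) (fun h => h.2.1.disjoint))

/-- Totally incomparable Banach spaces: no infinite-dimensional closed subspace of `X` is
isomorphic (linearly homeomorphic) to a closed subspace of `Y`. -/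
def TotallyIncomparable (X Y : Type) [NormedAddCommGroup X] [NormedSpace ℝ X]
    [NormedAddCommGroup Y] [NormedSpace ℝ Y] : Prop :=
  ∀ (U : Submodule ℝ X) (V : Submodule ℝ Y), IsClosed (U : Set X) → IsClosed (V : Set Y) →
    ¬ FiniteDimensional ℝ U → IsEmpty (U ≃L[ℝ] V)

end MixedTsirelson

end

open Filter Topology

noncomputable section

namespace MixedTsirelson

/-! ### Schreier families are spreading and hereditary -/

/-! Suppose `T` maps an infinite-dimensional subspace of X isomorphically onto a subspace of the
Tsirelson space. A gliding hump (`exists_hump`, `totallyIncomparable_of_blocks`) produces vectors `w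
n` such that `w n` and `T (w n)` are, up to small errors, finitely supported in the same successive
intervals `[p n, p (n + 1))`. It then suffices to find coefficients that separate the two norms on
such blocks by an arbitrarily large factor.

The coefficients are convex combinations over index sets `F` with `p(F)` in the Schreier family of
order `k + 1`. In X they have norm at least `θ_{k+1} / 2` (`norm_sum_block_ge`): almost norming
functionals of the blocks form an admissible family. Admissible families are allowed in all the
spaces considered, so the modified and boundedly modified cases need no separate argument.

In the Tsirelson space each norming functional is at most `δ ^ k` on the blocks, except for indices
in a set that is combinatorially small (`exists_light`). The combinations are chosen spread out
enough to give every such set negligible weight (`exists_isSpread`), so their norm is at most `2 * δ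
^ k` (`tsirelson_norm_sum_le`). Since `θ_n^{1/n} → 1 > δ`, the ratio `θ_{k+1} / δ ^ k` is unbounded
(`exists_mul_pow_lt`), a contradiction.

For the 2-convexifications, coefficients `√a_n` on disjoint blocks turn into coefficients `a_n` on
their squares (`sq_sum_sqrt_smul`), which reduces the estimates to the previous ones. -/

/-- An injection of `B` into `A` that moves points to the left can be made increasing. -/
lemma exists_strictMonoOn_le (B : Finset ℕ+) : ∀ (A : Finset ℕ+) (ψ : ℕ+ → ℕ+),
    Set.InjOn ψ B → (∀ b ∈ B, ψ b ∈ A ∧ ψ b ≤ b) →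
    ∃ φ : ℕ+ → ℕ+, StrictMonoOn φ B ∧ ∀ b ∈ B, φ b ∈ A ∧ φ b ≤ b := by
  induction B using Finset.induction_on_max with
  | empty => intro A ψ _ _; exact ⟨id, by simp [StrictMonoOn], by simp⟩
  | insert b B hb ih =>
    intro A ψ hinj hψ
    have hbB : b ∉ B := fun h => lt_irrefl _ (hb b h)
    -- The last point `b` receives the largest value, attained at `b₀ ≤ b`. The old value at `b`
    -- passes to `b₀`, where it is still admissible since `ψ b ≤ ψ b₀ ≤ b₀`. Erasing `ψ b₀` from the
    -- target of the induction keeps all other values strictly below it.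
    obtain ⟨b₀, hb₀, hmax⟩ := Finset.exists_max_image (insert b B) ψ ⟨b, by simp⟩
    have hb₀b : b₀ ≤ b := by
      rcases Finset.mem_insert.1 hb₀ with h | h
      · exact h.le
      · exact (hb _ h).le
    have hswap : ∀ x ∈ B, Equiv.swap b₀ b x ∈ insert b B := by
      intro x hx
      rw [Equiv.swap_apply_def]
      split_ifs <;> simp_all
    have hne : ∀ x ∈ B, Equiv.swap b₀ b x ≠ b₀ := by
      intro x hx h
      have : x = b := by
        exact (Equiv.swap b₀ b).injective (h.trans (Equiv.swap_apply_right b₀ b).symm)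
      exact hbB (this ▸ hx)
    obtain ⟨φ, hφm, hφ⟩ := ih (((insert b B).image ψ).erase (ψ b₀))
      (fun x => ψ (Equiv.swap b₀ b x))
      (fun x hx y hy h => (Equiv.swap b₀ b).injective
        (hinj (hswap x hx) (hswap y hy) h))
      (fun x hx => by
        refine ⟨Finset.mem_erase.2 ⟨fun h => hne x hx (hinj (hswap x hx) hb₀ h),
          Finset.mem_image_of_mem _ (hswap x hx)⟩, ?_⟩
        rcases eq_or_ne x b₀ with rfl | hx0
        · rw [Equiv.swap_apply_left]
          exact (hmax b (by simp)).trans (hψ _ hb₀).2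
        · rw [Equiv.swap_apply_of_ne_of_ne hx0 (ne_of_mem_of_not_mem hx hbB)]
          exact (hψ x (Finset.mem_insert_of_mem hx)).2)
    have hφlt : ∀ x ∈ B, φ x < ψ b₀ := by
      intro x hx
      obtain ⟨h1, h2⟩ := Finset.mem_erase.1 (hφ x hx).1
      obtain ⟨y, hy, hxy⟩ := Finset.mem_image.1 h2
      exact lt_of_le_of_ne (hxy ▸ hmax y hy) h1
    refine ⟨Function.update φ b (ψ b₀), ?_, ?_⟩
    · intro x hx y hy hxy
      have hx' := Finset.mem_insert.1 (Finset.mem_coe.1 hx)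
      have hy' := Finset.mem_insert.1 (Finset.mem_coe.1 hy)
      rcases hx' with rfl | hx'
      · rcases hy' with rfl | hy'
        · exact absurd hxy (lt_irrefl _)
        · exact absurd hxy (hb y hy').not_gt
      · rw [Function.update_of_ne (ne_of_mem_of_not_mem hx' hbB)]
        rcases hy' with rfl | hy'
        · rw [Function.update_self]; exact hφlt x hx'
        · rw [Function.update_of_ne (ne_of_mem_of_not_mem hy' hbB)]
          exact hφm hx' hy' hxy
    · intro x hx
      rcases Finset.mem_insert.1 hx with rfl | hx'
      · rw [Function.update_self]
        exact ⟨(hψ _ hb₀).1, (hψ _ hb₀).2.trans hb₀b⟩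
      · rw [Function.update_of_ne (ne_of_mem_of_not_mem hx' hbB)]
        refine ⟨?_, (hφ x hx').2⟩
        obtain ⟨y, hy, hxy⟩ := Finset.mem_image.1 (Finset.mem_of_mem_erase (hφ x hx').1)
        exact hxy ▸ (hψ y hy).1

/-- A decomposition of `A` pulls back along `ψ`: monotonicity keeps the pieces successive, and
moving points to the right preserves the lower bound `d`. -/
lemma schreier_of_strictMonoOn (k : ℕ) : ∀ {A B : Finset ℕ+}, A ∈ schreier k →
    ∀ ψ : ℕ+ → ℕ+, StrictMonoOn ψ B → (∀ b ∈ B, ψ b ∈ A ∧ ψ b ≤ b) → B ∈ schreier k := by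
  induction k with
  | zero =>
    rintro A B (rfl | ⟨n, rfl⟩) ψ hm hψ
    · refine Or.inl (Finset.eq_empty_of_forall_notMem fun b hb => ?_)
      simpa using (hψ b hb).1
    · rcases B.eq_empty_or_nonempty with h | ⟨b, hb⟩
      · exact Or.inl h
      · refine Or.inr ⟨b, Finset.eq_singleton_iff_unique_mem.2 ⟨hb, fun c hc => ?_⟩⟩
        refine hm.injOn hc hb ?_
        rw [Finset.mem_singleton.1 (hψ b hb).1, Finset.mem_singleton.1 (hψ c hc).1]
  | succ k ih =>
    rintro A B ⟨d, E, hE, hd, hs, rfl⟩ ψ hm hψ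
    refine ⟨d, fun i => B.filter fun b => ψ b ∈ E i, fun i => ?_, fun i b hb => ?_,
      fun i j hij a ha b hb => ?_, ?_⟩
    · refine ih (hE i) ψ (hm.mono fun b hb => (Finset.mem_filter.1 hb).1) fun b hb => ?_
      rw [Finset.mem_filter] at hb
      exact ⟨hb.2, (hψ b hb.1).2⟩
    · rw [Finset.mem_filter] at hb
      exact (hd i _ hb.2).trans (hψ b hb.1).2
    · rw [Finset.mem_filter] at ha hb
      exact (hm.lt_iff_lt ha.1 hb.1).1 (hs i j hij _ ha.2 _ hb.2)
    · ext b
      simp only [Finset.mem_biUnion, Finset.mem_univ, true_and, Finset.mem_filter]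
      constructor
      · intro hb
        obtain ⟨i, _, hi⟩ := Finset.mem_biUnion.1 (hψ b hb).1
        exact ⟨i, hb, hi⟩
      · rintro ⟨i, hb, _⟩; exact hb

/-- The Schreier families are hereditary and spreading. -/
lemma schreier_image {k : ℕ} {ι ι' : Type} [Fintype ι] [Fintype ι'] {m : ι → ℕ+} {m' : ι' → ℕ+}
    (h : Finset.univ.image m ∈ schreier k) (hm : Function.Injective m)
    (hm' : Function.Injective m') {e : ι' → ι} (he : Function.Injective e)
    (hle : ∀ i, m (e i) ≤ m' i) : Finset.univ.image m' ∈ schreier k := by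
  have hext : ∀ i, Function.extend m' (fun i => m (e i)) id (m' i) = m (e i) :=
    fun i => hm'.extend_apply _ _ i
  obtain ⟨φ, h1, h2⟩ := exists_strictMonoOn_le (Finset.univ.image m') (Finset.univ.image m)
    (Function.extend m' (fun i => m (e i)) id)
    (by
      intro a ha b hb hab
      obtain ⟨i, _, rfl⟩ := Finset.mem_image.1 (Finset.mem_coe.1 ha)
      obtain ⟨j, _, rfl⟩ := Finset.mem_image.1 (Finset.mem_coe.1 hb)
      rw [hext, hext] at hab
      rw [he (hm hab)])
    (by
      intro a ha
      obtain ⟨i, _, rfl⟩ := Finset.mem_image.1 ha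
      rw [hext]
      exact ⟨Finset.mem_image_of_mem _ (Finset.mem_univ _), hle i⟩)
  exact schreier_of_strictMonoOn k h φ h1 h2

lemma minima_injective {d : ℕ} {E : Fin d → Finset ℕ+}
    (hE : Pairwise fun i j => Disjoint (E i) (E j)) {m : Fin d → ℕ+}
    (hm : ∀ i, m i ∈ E i) : Function.Injective m := by
  intro i j hij
  by_contra h
  exact Finset.disjoint_left.1 (hE h) (hm i) (hij ▸ hm j)

/-! ### Restrictions of functionals -/

/-- A class of sequences of sets that is stable under passing to subsequences and to nonempty
subsets. -/
def Hereditary (P : ∀ d : ℕ, (Fin d → Finset ℕ+) → Prop) : Prop :=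
  ∀ ⦃d : ℕ⦄ ⦃E : Fin d → Finset ℕ+⦄ ⦃d' : ℕ⦄ ⦃E' : Fin d' → Finset ℕ+⦄ (e : Fin d' ↪o Fin d),
    (∀ i, (E' i).Nonempty) → (∀ i, E' i ⊆ E (e i)) → P d E → P d' E'

lemma hereditary_allowable (k : ℕ) : Hereditary fun _ E => Allowable (schreier k) E := by
  rintro d E d' E' e hne hsub ⟨hdis, m, hm, hmem⟩
  have hdis' : Pairwise fun i j => Disjoint (E' i) (E' j) := fun i j hij =>
    Finset.disjoint_of_subset_left (hsub i)
      (Finset.disjoint_of_subset_right (hsub j) (hdis (e.injective.ne hij)))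
  refine ⟨hdis', fun i => (E' i).min' (hne i), fun i => Finset.isLeast_min' _ _, ?_⟩
  exact schreier_image hmem (minima_injective hdis fun i => (hm i).1)
    (minima_injective hdis' fun i => Finset.min'_mem _ _) e.injective
    fun i => (hm (e i)).2 (hsub i (Finset.min'_mem _ (hne i)))

lemma Admissible.allowable {M : Set (Finset ℕ+)} {d : ℕ} {E : Fin d → Finset ℕ+}
    (h : Admissible M E) : Allowable M E := ⟨h.1.disjoint, h.2⟩

lemma hereditary_admissible (k : ℕ) : Hereditary fun _ E => Admissible (schreier k) E := by
  intro d E d' E' e hne hsub h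
  exact ⟨fun i j hij a ha b hb => h.1 _ _ (e.lt_iff_lt.2 hij) a (hsub i ha) b (hsub j hb),
    (hereditary_allowable k e hne hsub h.allowable).2⟩

/-- A restriction may vanish, and zero is not among the generators. In a sum the vanishing summands
are discarded and the others reindexed in increasing order; heredity allows both the subsequence and
the smaller supports. -/
lemma Generated.filter {ι : Type} {θ : ι → ℝ} {P : ι → ∀ d : ℕ, (Fin d → Finset ℕ+) → Prop}
    (hP : ∀ i, Hereditary (P i)) (A : Set ℕ+) [DecidablePred (· ∈ A)] {f : C00}
    (hf : Generated θ P f) :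
    f.filter (· ∈ A) = 0 ∨ Generated θ P (f.filter (· ∈ A)) := by
  induction hf with
  | pos n =>
    by_cases h : n ∈ A
    · rw [Finsupp.filter_single_of_pos _ h]; exact Or.inr (.pos n)
    · rw [Finsupp.filter_single_of_neg _ h]; exact Or.inl rfl
  | neg n =>
    rw [Finsupp.filter_neg]
    by_cases h : n ∈ A
    · rw [Finsupp.filter_single_of_pos _ h]; exact Or.inr (.neg n)
    · rw [Finsupp.filter_single_of_neg _ h]; exact Or.inl neg_zero
  | sum i d hd f hf hE ih =>
    classical
    have hsum : (θ i • ∑ j, f j).filter (· ∈ A) = θ i • ∑ j, (f j).filter (· ∈ A) := by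
      rw [Finsupp.filter_smul, Finsupp.filter_sum]
    set J : Finset (Fin d) := Finset.univ.filter fun j => (f j).filter (· ∈ A) ≠ 0 with hJ
    have hJsum : ∑ j, (f j).filter (· ∈ A) = ∑ j ∈ J, (f j).filter (· ∈ A) :=
      (Finset.sum_filter_ne_zero _).symm
    rcases J.eq_empty_or_nonempty with h | h
    · left
      rw [hsum, hJsum, h]; simp
    · right
      have hemb : ∑ j ∈ J, (f j).filter (· ∈ A) =
          ∑ l : Fin J.card, (f (J.orderEmbOfFin rfl l)).filter (· ∈ A) := by
        conv_lhs => rw [← J.map_orderEmbOfFin_univ rfl]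
        rw [Finset.sum_map]; rfl
      have hmem : ∀ l, (f (J.orderEmbOfFin rfl l)).filter (· ∈ A) ≠ 0 := fun l =>
        (Finset.mem_filter.1 (J.orderEmbOfFin_mem rfl l)).2
      rw [hsum, hJsum, hemb]
      refine .sum i _ (Finset.card_pos.2 h) _ (fun l => (ih _).resolve_left (hmem l)) ?_
      refine hP i (J.orderEmbOfFin rfl) (fun l => Finsupp.support_nonempty_iff.2 (hmem l))
        (fun l => ?_) hE
      rw [Finsupp.support_filter]
      exact Finset.filter_subset _ _

/-! ### The lower estimate -/

lemma pairing_smul_sum {d : ℕ} (c : ℝ) (f : Fin d → C00) (x : C00) :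
    Finsupp.linearCombination ℝ (⇑(c • ∑ j, f j)) x =
      c * ∑ j, Finsupp.linearCombination ℝ (⇑(f j)) x := by
  simp only [NormingSet.pairing_eq (s := x.support) subset_rfl, Finsupp.smul_apply,
    Finsupp.finsetSum_apply, smul_eq_mul]
  rw [Finset.sum_comm, Finset.mul_sum]
  refine Finset.sum_congr rfl fun n _ => ?_
  rw [← Finset.mul_sum]; ring

lemma pairing_eq_zero {f x : C00} (h : ∀ i ∈ x.support, f i = 0) :
    Finsupp.linearCombination ℝ (⇑f) x = 0 := by
  rw [NormingSet.pairing_eq subset_rfl]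
  exact Finset.sum_eq_zero fun i hi => by rw [h i hi, mul_zero]

/-- `x` is a sequence of blocks: `p n ≤ supp (x n) < p (n + 1)`. -/
def IsBlock (p : ℕ → ℕ+) (x : ℕ → C00) : Prop :=
  ∀ n, ∀ i ∈ (x n).support, p n ≤ i ∧ i < p (n + 1)

lemma eq_of_mem_block {p : ℕ → ℕ+} (hp : StrictMono p) {i : ℕ+} {n m : ℕ}
    (hn : p n ≤ i ∧ i < p (n + 1)) (hm : p m ≤ i ∧ i < p (m + 1)) : n = m := by
  have h1 := hp.lt_iff_lt.1 (hn.1.trans_lt hm.2)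
  have h2 := hp.lt_iff_lt.1 (hm.1.trans_lt hn.2)
  omega

/-- Choose `g n` in the norming set with value at least `1 / 2` on `x n`, restricted to the interval
of the `n`-th block. The minima of the supports lie to the right of the points `p n`, so the
spreading property makes the family admissible, and `θ k` times its sum is a test functional. -/
lemma norm_sum_block_ge {θ : ℕ+ → ℝ} (hθ : ∀ i, 0 < θ i ∧ θ i < 1)
    {P : ℕ+ → ∀ d : ℕ, (Fin d → Finset ℕ+) → Prop}
    (hP : ∀ i d E, P i d E → Pairwise (fun j k => Disjoint (E j) (E k)))
    (hher : ∀ i, Hereditary (P i))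
    (hadm : ∀ (i : ℕ+) (d : ℕ) (E : Fin d → Finset ℕ+), Admissible (schreier i) E → P i d E)
    {p : ℕ → ℕ+} (hp : StrictMono p) {x : ℕ → C00} (hx : IsBlock p x)
    (hx1 : ∀ n, 1 ≤ (generatedSet θ hθ P hP).norm (x n))
    {k : ℕ+} {F : Finset ℕ} (hF : F.image p ∈ schreier k) {a : ℕ → ℝ} (ha : ∀ n, 0 ≤ a n)
    (ha1 : ∑ n ∈ F, a n = 1) :
    θ k / 2 ≤ (generatedSet θ hθ P hP).norm (∑ n ∈ F, a n • x n) := by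
  classical
  have hex : ∀ n, ∃ g : C00, Generated θ P g ∧ (∀ i ∈ g.support, p n ≤ i ∧ i < p (n + 1)) ∧
      1 / 2 ≤ Finsupp.linearCombination ℝ (⇑g) (x n) := by
    intro n
    obtain ⟨⟨f, hf⟩, hfn⟩ := exists_lt_of_lt_ciSup
      (lt_of_lt_of_le (by norm_num : (1 / 2 : ℝ) < 1) (hx1 n))
    have heq : Finsupp.linearCombination ℝ (⇑(f.filter (· ∈ Set.Ico (p n) (p (n + 1))))) (x n)
        = Finsupp.linearCombination ℝ (⇑f) (x n) := by
      rw [NormingSet.pairing_eq subset_rfl, NormingSet.pairing_eq subset_rfl]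
      refine Finset.sum_congr rfl fun i hi => ?_
      rw [Finsupp.filter_apply_pos]
      exact hx n i hi
    refine ⟨f.filter (· ∈ Set.Ico (p n) (p (n + 1))), ?_, fun i hi => ?_, ?_⟩
    · refine (Generated.filter hher (Set.Ico (p n) (p (n + 1))) hf).resolve_left fun h0 => ?_
      rw [h0, pairing_eq_zero (by simp)] at heq
      simp only [← heq] at hfn
      norm_num at hfn
    · rw [Finsupp.support_filter] at hi
      exact (Finset.mem_filter.1 hi).2
    · rw [heq]; exact hfn.le
  choose g hg hgs hgx using hex
  have hFne : F.Nonempty := by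
    rw [Finset.nonempty_iff_ne_empty]; rintro rfl; simp at ha1
  set e := F.orderEmbOfFin rfl
  have hsucc : Successive fun l => (g (e l)).support := by
    intro i j hij b hb c hc
    have h1 : e i + 1 ≤ e j := e.lt_iff_lt.2 hij
    exact (hgs _ b hb).2.trans_le ((hp.monotone h1).trans (hgs _ c hc).1)
  have hgne : ∀ n, (g n).support.Nonempty := by
    intro n
    rw [Finsupp.support_nonempty_iff]
    intro h0
    have := hgx n
    rw [h0, pairing_eq_zero (by simp)] at this
    norm_num at this
  have hA : Admissible (schreier k) fun l => (g (e l)).support := by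
    refine ⟨hsucc, fun l => (g (e l)).support.min' (hgne _), fun l => Finset.isLeast_min' _ _, ?_⟩
    -- The points `p n` move right to the minima of the supports.
    refine schreier_image (m := fun l => p (e l)) ?_ (hp.injective.comp e.injective)
      (minima_injective hsucc.disjoint fun i => Finset.min'_mem _ _) Function.injective_id
      fun i => (hgs _ _ (Finset.min'_mem _ (hgne _))).1
    convert hF using 1
    conv_rhs => rw [← F.image_orderEmbOfFin_univ rfl]
    rw [Finset.image_image]; rfl
  have hgen := Generated.sum (θ := θ) (P := P) k _ (Finset.card_pos.2 hFne) (fun l => g (e l))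
    (fun l => hg _) (hadm k _ _ hA)
  refine le_trans ?_ (NormingSet.pairing_le (generatedSet θ hθ P hP) hgen _)
  rw [pairing_smul_sum]
  have hS : ∑ l, Finsupp.linearCombination ℝ (⇑(g (e l))) (∑ n ∈ F, a n • x n)
      = ∑ n ∈ F, a n * Finsupp.linearCombination ℝ (⇑(g n)) (x n) := by
    have : ∀ m ∈ F, Finsupp.linearCombination ℝ (⇑(g m)) (∑ n ∈ F, a n • x n)
        = a m * Finsupp.linearCombination ℝ (⇑(g m)) (x m) := by
      intro m hm
      rw [map_sum, Finset.sum_eq_single_of_mem m hm, map_smul, smul_eq_mul]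
      intro n _ hnm
      rw [map_smul, pairing_eq_zero, smul_zero]
      intro i hi
      by_contra h
      exact hnm (eq_of_mem_block hp (hx n i hi) (hgs m i (Finsupp.mem_support_iff.2 h)))
    rw [← Finset.sum_congr rfl this]
    generalize ∑ n ∈ F, a n • x n = z
    conv_rhs => rw [← F.map_orderEmbOfFin_univ rfl]
    rw [Finset.sum_map]; rfl
  have hge : (1 / 2 : ℝ) ≤ ∑ n ∈ F, a n * Finsupp.linearCombination ℝ (⇑(g n)) (x n) := by
    calc (1 / 2 : ℝ) = ∑ n ∈ F, a n * (1 / 2) := by rw [← Finset.sum_mul, ha1, one_mul]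
      _ ≤ _ := Finset.sum_le_sum fun n _ => mul_le_mul_of_nonneg_left (hgx n) (ha n)
  rw [hS]
  have := mul_le_mul_of_nonneg_left hge (hθ k).1.le
  linarith

/-! ### Light sets and spread averages -/

/-- The index sets on which a functional of the Tsirelson space may be larger than `δ ^ k`. -/
def light (p : ℕ → ℕ+) : ℕ → Set (Finset ℕ)
  | 0 => {∅}
  | k + 1 => {G | ∃ (d : ℕ) (S : Finset ℕ) (B : Fin d → Finset ℕ), S.card ≤ d ∧
      (∀ i, B i ∈ light p k) ∧ G ⊆ S ∪ Finset.univ.biUnion B ∧ ∀ n ∈ G, d ≤ (p (n + 1) : ℕ)}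

lemma empty_mem_light (p : ℕ → ℕ+) (k : ℕ) : ∅ ∈ light p k := by
  cases k with
  | zero => rfl
  | succ k => exact ⟨0, ∅, fun _ => ∅, by simp, fun i => i.elim0, by simp, by simp⟩

lemma singleton_mem_light (p : ℕ → ℕ+) (k n : ℕ) : {n} ∈ light p (k + 1) :=
  ⟨1, {n}, fun _ => ∅, by simp, fun _ => empty_mem_light p k, by simp,
    fun _ _ => (p _).pos⟩

/-- Convex combinations supported after `m` on a set in `F_{k+1}`, with small coefficients and
of small weight on light sets. -/
structure IsSpread (p : ℕ → ℕ+) (k : ℕ) (ε : ℝ) (m : ℕ) (F : Finset ℕ) (a : ℕ → ℝ) : Prop where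
  nonneg : ∀ n, 0 ≤ a n
  eq_zero : ∀ n, n ∉ F → a n = 0
  sum_eq : ∑ n ∈ F, a n = 1
  le : ∀ n ∈ F, m ≤ n
  mem : F.image p ∈ schreier (k + 1)
  apply_le : ∀ n, a n ≤ ε
  light_le : ∀ G ∈ light p k, ∑ n ∈ G, a n ≤ ε

namespace IsSpread

variable {p : ℕ → ℕ+} {k : ℕ} {ε : ℝ} {m : ℕ} {F : Finset ℕ} {a : ℕ → ℝ}

lemma nonempty (h : IsSpread p k ε m F a) : F.Nonempty := by
  rw [Finset.nonempty_iff_ne_empty]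
  rintro rfl
  simpa using h.sum_eq

lemma sum_le_one (h : IsSpread p k ε m F a) (G : Finset ℕ) : ∑ n ∈ G, a n ≤ 1 := by
  classical
  rw [← h.sum_eq]
  calc ∑ n ∈ G, a n ≤ ∑ n ∈ G ∪ F, a n :=
        Finset.sum_le_sum_of_subset_of_nonneg Finset.subset_union_left fun n _ _ => h.nonneg n
    _ = ∑ n ∈ F, a n := by
        symm
        exact Finset.sum_subset Finset.subset_union_right fun n _ hn => h.eq_zero n hn

lemma sum_biUnion_le_of_nonneg {d : ℕ} (B : Fin d → Finset ℕ) {a : ℕ → ℝ} (ha : ∀ n, 0 ≤ a n) :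
    ∑ n ∈ Finset.univ.biUnion B, a n ≤ ∑ i, ∑ n ∈ B i, a n := by
  classical
  generalize (Finset.univ : Finset (Fin d)) = I
  induction I using Finset.induction_on with
  | empty => simp
  | insert i I hi ih =>
    have h1 : ∑ n ∈ B i ∪ I.biUnion B, a n + ∑ n ∈ B i ∩ I.biUnion B, a n =
        ∑ n ∈ B i, a n + ∑ n ∈ I.biUnion B, a n := Finset.sum_union_inter
    have h2 : 0 ≤ ∑ n ∈ B i ∩ I.biUnion B, a n := Finset.sum_nonneg fun n _ => ha n
    rw [Finset.biUnion_insert, Finset.sum_insert hi]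
    linarith

/-- A light set of the next level costs at most `ε` for each of the `d` single indices and each of
the `d` light pieces. The price grows with `d`, which the next averaging step must absorb. -/
lemma sum_succ_le (h : IsSpread p k ε m F a) {d : ℕ} {S G : Finset ℕ} {B : Fin d → Finset ℕ}
    (hS : S.card ≤ d) (hB : ∀ i, B i ∈ light p k) (hG : G ⊆ S ∪ Finset.univ.biUnion B)
    (hε : 0 ≤ ε) : ∑ n ∈ G, a n ≤ 2 * d * ε := by
  classical
  have h1 : ∑ n ∈ S, a n ≤ d * ε := by
    calc ∑ n ∈ S, a n ≤ S.card • ε := Finset.sum_le_card_nsmul _ _ _ fun n _ => h.apply_le n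
      _ ≤ d * ε := by
        rw [nsmul_eq_mul]
        exact mul_le_mul_of_nonneg_right (by exact_mod_cast hS) hε
  have h2 : ∑ n ∈ Finset.univ.biUnion B, a n ≤ d * ε := by
    calc ∑ n ∈ Finset.univ.biUnion B, a n ≤ ∑ i, ∑ n ∈ B i, a n :=
          sum_biUnion_le_of_nonneg _ h.nonneg
      _ ≤ ∑ _i : Fin d, ε := Finset.sum_le_sum fun i _ => h.light_le _ (hB i)
      _ = d * ε := by simp
  calc ∑ n ∈ G, a n ≤ ∑ n ∈ S ∪ Finset.univ.biUnion B, a n :=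
        Finset.sum_le_sum_of_subset_of_nonneg hG fun n _ _ => h.nonneg n
    _ ≤ ∑ n ∈ S, a n + ∑ n ∈ Finset.univ.biUnion B, a n := by
        rw [← Finset.sum_union_inter]
        exact le_add_of_nonneg_right (Finset.sum_nonneg fun n _ => h.nonneg n)
    _ ≤ 2 * d * ε := by linarith

end IsSpread

lemma le_coe_of_strictMono {p : ℕ → ℕ+} (hp : StrictMono p) (n : ℕ) : n ≤ (p n : ℕ) :=
  StrictMono.le_apply (f := fun n => (p n : ℕ)) fun _ _ h => PNat.coe_lt_coe _ _ |>.2 (hp h)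

/-- Uniform average over `N` consecutive indices, started beyond `N` so that their images under `p`
form a Schreier set. -/
lemma exists_isSpread_zero {p : ℕ → ℕ+} (hp : StrictMono p) {ε : ℝ} (hε : 0 < ε) (m : ℕ) :
    ∃ F a, IsSpread p 0 ε m F a := by
  obtain ⟨N, hN⟩ := exists_nat_gt (1 / ε)
  have hN0 : (0 : ℝ) < N := lt_trans (by positivity) hN
  have hNε : 1 / (N : ℝ) ≤ ε := by
    rw [div_le_iff₀ hN0]; rw [div_lt_iff₀ hε] at hN; linarith
  set q := max m N
  refine ⟨Finset.Ico q (q + N), fun n => if n ∈ Finset.Ico q (q + N) then 1 / (N : ℝ) else 0,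
    fun n => by split_ifs <;> positivity, fun n hn => if_neg hn, ?_, fun n hn => ?_, ?_,
    fun n => by split_ifs <;> [exact hNε; exact hε.le], ?_⟩
  · rw [Finset.sum_congr rfl fun n hn => if_pos hn]
    simp [hN0.ne']
  · exact (le_max_left _ _).trans (Finset.mem_Ico.1 hn).1
  · refine ⟨N, fun i => {p (q + i)}, fun i => Or.inr ⟨_, rfl⟩, ?_, ?_, ?_⟩
    · intro i b hb
      rw [Finset.mem_singleton.1 hb]
      exact ((le_max_right m N).trans (Nat.le_add_right _ _)).trans (le_coe_of_strictMono hp _)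
    · intro i j hij b hb c hc
      rw [Finset.mem_singleton.1 hb, Finset.mem_singleton.1 hc]
      exact hp (by simpa using hij)
    · ext b
      simp only [Finset.mem_image, Finset.mem_Ico, Finset.mem_biUnion, Finset.mem_univ, true_and,
        Finset.mem_singleton]
      constructor
      · rintro ⟨n, hn, rfl⟩
        exact ⟨⟨n - q, by omega⟩, by congr 1; simp; omega⟩
      · rintro ⟨i, rfl⟩
        exact ⟨q + i, by have := i.2; omega, rfl⟩
  · rintro G rfl
    simpa using hε.le

/-- Average `N` successive spread combinations, each far more spread out than its starting point is
large. If a light set first meets the `i₀`-th of them, its parameter `d` is bounded by the starting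
value of every later one, so each later one contributes at most `1 / N`; the `i₀`-th contributes at
most `1`. The total before dividing by `N` is at most `2`. -/
lemma exists_isSpread_succ {p : ℕ → ℕ+} (hp : StrictMono p) {k : ℕ}
    (ih : ∀ ε : ℝ, 0 < ε → ∀ m, ∃ F a, IsSpread p k ε m F a) {ε : ℝ} (hε : 0 < ε) (m : ℕ) :
    ∃ F a, IsSpread p (k + 1) ε m F a := by
  classical
  obtain ⟨N, hN⟩ := exists_nat_gt (2 / ε)
  have hN0 : (0 : ℝ) < N := lt_trans (by positivity) hN
  have hN1 : 1 ≤ N := by exact_mod_cast hN0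
  have hNε : 2 / (N : ℝ) ≤ ε := by
    rw [div_le_iff₀ hN0]; rw [div_lt_iff₀ hε] at hN; linarith
  -- With this tolerance, `d ≤ p l` turns the bound `2 * d * η l` of `sum_succ_le` into `1 / N`.
  set η : ℕ → ℝ := fun l => 1 / (2 * N * (p l : ℕ)) with hη
  have hp0 : ∀ l, (0 : ℝ) < (p l : ℕ) := fun l => by exact_mod_cast (p l).pos
  have hη0 : ∀ l, 0 < η l := fun l => by have := hp0 l; positivity
  choose F a hFa using fun l => ih (η l) (hη0 l) l
  -- `q i` is the starting index of the `i`-th combination, just past the last index of the previous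
  -- one.
  obtain ⟨q, hq0, hq1⟩ : ∃ q : ℕ → ℕ, q 0 = max m N ∧ ∀ i, q (i + 1) = (F (q i)).sup id + 1 :=
    ⟨fun i => Nat.rec (max m N) (fun _ l => (F l).sup id + 1) i, rfl, fun _ => rfl⟩
  have hFlt : ∀ i, ∀ n ∈ F (q i), n < q (i + 1) := fun i n hn => by
    rw [hq1]; exact Nat.lt_succ_of_le (Finset.le_sup (f := id) hn)
  have hqmono : StrictMono q := by
    refine strictMono_nat_of_lt_succ fun i => ?_
    obtain ⟨n, hn⟩ := (hFa (q i)).nonempty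
    exact ((hFa (q i)).le n hn).trans_lt (hFlt i n hn)
  have hqN : ∀ i, max m N ≤ q i := fun i => hq0 ▸ hqmono.monotone (Nat.zero_le i)
  have hdisj : ∀ {i j n}, n ∈ F (q i) → n ∈ F (q j) → i = j := by
    intro i j n hi hj
    have h1 : q i < q (j + 1) := ((hFa _).le n hi).trans_lt (hFlt j n hj)
    have h2 : q j < q (i + 1) := ((hFa _).le n hj).trans_lt (hFlt i n hi)
    rw [hqmono.lt_iff_lt] at h1 h2
    omega
  set F' := (Finset.range N).biUnion fun i => F (q i) with hF'
  set a' : ℕ → ℝ := fun n => 1 / (N : ℝ) * ∑ i ∈ Finset.range N, a (q i) n with ha'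
  have hsum : ∀ G : Finset ℕ, ∑ n ∈ G, a' n
      = 1 / (N : ℝ) * ∑ i ∈ Finset.range N, ∑ n ∈ G, a (q i) n := fun G => by
    rw [ha', ← Finset.mul_sum, Finset.sum_comm]
  have ha0 : ∀ i n, n ∉ F (q i) → a (q i) n = 0 := fun i n hn => (hFa _).eq_zero n hn
  have hηN : ∀ i, i ∈ Finset.range N → η (q i) ≤ 1 := fun i _ => by
    have h1 : (1 : ℝ) ≤ N := by exact_mod_cast hN1
    have h2 : (1 : ℝ) ≤ (p (q i) : ℕ) := by exact_mod_cast (p (q i)).pos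
    rw [hη]
    refine div_le_one_of_le₀ ?_ (by positivity)
    nlinarith [mul_le_mul h1 h2 zero_le_one (by positivity)]
  refine ⟨F', a', fun n => ?_, fun n hn => ?_, ?_, fun n hn => ?_, ?_, fun n => ?_, ?_⟩
  · exact mul_nonneg (by positivity) (Finset.sum_nonneg fun i _ => (hFa _).nonneg n)
  · rw [ha']
    simp only
    rw [Finset.sum_eq_zero, mul_zero]
    intro i hi
    exact ha0 i n fun h => hn (Finset.mem_biUnion.2 ⟨i, hi, h⟩)
  · rw [hsum]
    have : ∀ i ∈ Finset.range N, ∑ n ∈ F', a (q i) n = 1 := fun i hi => by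
      rw [← (hFa (q i)).sum_eq]
      symm
      exact Finset.sum_subset (Finset.subset_biUnion_of_mem (fun i => F (q i)) hi)
        fun n _ hn => ha0 i n hn
    rw [Finset.sum_congr rfl this]
    simp [hN0.ne']
  · obtain ⟨i, _, hi⟩ := Finset.mem_biUnion.1 hn
    exact (le_max_left _ _).trans ((hqN i).trans ((hFa _).le n hi))
  · refine ⟨N, fun i => (F (q i)).image p, fun i => (hFa _).mem, ?_, ?_, ?_⟩
    · intro i b hb
      obtain ⟨n, hn, rfl⟩ := Finset.mem_image.1 hb
      exact ((le_max_right m N).trans ((hqN i).trans ((hFa _).le n hn))).trans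
        (le_coe_of_strictMono hp _)
    · intro i j hij b hb c hc
      obtain ⟨n, hn, rfl⟩ := Finset.mem_image.1 hb
      obtain ⟨l, hl, rfl⟩ := Finset.mem_image.1 hc
      have h1 : (i : ℕ) + 1 ≤ j := hij
      exact hp ((hFlt i n hn).trans_le ((hqmono.monotone h1).trans ((hFa _).le l hl)))
    · ext b
      simp only [hF', Finset.mem_image, Finset.mem_biUnion, Finset.mem_univ, true_and,
        Finset.mem_range]
      constructor
      · rintro ⟨n, ⟨i, hi, hn⟩, rfl⟩
        exact ⟨⟨i, hi⟩, n, hn, rfl⟩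
      · rintro ⟨i, n, hn, rfl⟩
        exact ⟨n, ⟨i, i.2, hn⟩, rfl⟩
  · have h1 : ∑ i ∈ Finset.range N, a (q i) n ≤ 2 := by
      by_cases h : ∃ i ∈ Finset.range N, n ∈ F (q i)
      · obtain ⟨i, hi, hn⟩ := h
        rw [Finset.sum_eq_single_of_mem i hi]
        · exact ((hFa _).apply_le n).trans ((hηN i hi).trans one_le_two)
        · intro j _ hj
          exact ha0 j n fun h => hj (hdisj h hn)
      · push Not at h
        rw [Finset.sum_eq_zero fun i hi => ha0 i n (h i hi)]
        exact zero_le_two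
    calc a' n ≤ 1 / (N : ℝ) * 2 := mul_le_mul_of_nonneg_left h1 (by positivity)
      _ = 2 / N := by ring
      _ ≤ ε := hNε
  · rintro G ⟨d, S, B, hS, hB, hG, hd⟩
    obtain ⟨i₀, hi₀⟩ : ∃ i₀, ∀ i, i ≠ i₀ → ∑ n ∈ G, a (q i) n ≤ 1 / N := by
      by_cases h : ∃ i, ∃ n ∈ G, n ∈ F (q i)
      · obtain ⟨n, hnG, hn⟩ := Nat.find_spec h
        refine ⟨Nat.find h, fun i hi => ?_⟩
        rcases lt_or_gt_of_ne hi with hlt | hgt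
        · have := Nat.find_min h hlt
          push Not at this
          rw [Finset.sum_eq_zero fun n hn => ha0 i n (this n hn)]
          positivity
        · refine ((hFa (q i)).sum_succ_le hS hB hG (hη0 _).le).trans ?_
          -- The index `n` belongs to an earlier combination, so `n + 1 ≤ q i`; hence a bound on `d`
          -- by `p (n + 1)`, rather than `p n`, is good enough.
          have h1 : p (n + 1) ≤ p (q i) :=
            hp.monotone ((hFlt _ n hn).trans_le (hqmono.monotone hgt))
          have h2 : (d : ℝ) ≤ (p (q i) : ℕ) := by
            exact_mod_cast (hd n hnG).trans (PNat.coe_le_coe _ _ |>.2 h1)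
          have h3 := hp0 (q i)
          calc 2 * d * η (q i) ≤ 2 * (p (q i) : ℕ) * η (q i) := by
                have := (hη0 (q i)).le
                gcongr
            _ = 1 / N := by rw [hη]; field_simp
      · push Not at h
        refine ⟨0, fun i _ => ?_⟩
        rw [Finset.sum_eq_zero fun n hn => ha0 i n (h i n hn)]
        positivity
    rw [hsum]
    have h1 : ∑ i ∈ Finset.range N, ∑ n ∈ G, a (q i) n
        ≤ ∑ i ∈ Finset.range N, ((if i = i₀ then 1 else 0) + 1 / (N : ℝ)) := by
      refine Finset.sum_le_sum fun i _ => ?_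
      split_ifs with h
      · exact ((hFa _).sum_le_one G).trans (le_add_of_nonneg_right (by positivity))
      · rw [zero_add]; exact hi₀ i h
    have h2 : ∑ i ∈ Finset.range N, ((if i = i₀ then 1 else 0) + 1 / (N : ℝ)) ≤ 2 := by
      rw [Finset.sum_add_distrib, Finset.sum_ite_eq']
      have : ∑ _i ∈ Finset.range N, 1 / (N : ℝ) = 1 := by simp [hN0.ne']
      rw [this]
      split_ifs <;> norm_num
    calc 1 / (N : ℝ) * ∑ i ∈ Finset.range N, ∑ n ∈ G, a (q i) n ≤ 1 / (N : ℝ) * 2 :=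
          mul_le_mul_of_nonneg_left (h1.trans h2) (by positivity)
      _ = 2 / N := by ring
      _ ≤ ε := hNε

lemma exists_isSpread {p : ℕ → ℕ+} (hp : StrictMono p) (k : ℕ) :
    ∀ ε : ℝ, 0 < ε → ∀ m, ∃ F a, IsSpread p k ε m F a := by
  induction k with
  | zero => exact fun ε hε m => exists_isSpread_zero hp hε m
  | succ k ih => exact fun ε hε m => exists_isSpread_succ hp ih hε m

/-! ### The upper estimate in the Tsirelson space -/

/-- A set of the first Schreier family has at most as many elements as its minimum. -/
lemma le_of_mem_schreier_one {d : ℕ} {m : Fin d → ℕ+} (hm : Function.Injective m)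
    (h : Finset.univ.image m ∈ schreier 1) (i : Fin d) : d ≤ (m i : ℕ) := by
  classical
  obtain ⟨d', B, hB, hd', -, he⟩ := h
  have hcard : d ≤ d' := by
    calc d = (Finset.univ.image m).card := by
          rw [Finset.card_image_of_injective _ hm, Finset.card_fin]
      _ ≤ ∑ i, (B i).card := by rw [he]; exact Finset.card_biUnion_le
      _ ≤ ∑ _i : Fin d', 1 := Finset.sum_le_sum fun i _ => by
          rcases hB i with h | ⟨n, h⟩ <;> rw [h] <;> simp
      _ = d' := by simp
  have hi : m i ∈ Finset.univ.biUnion B := he ▸ Finset.mem_image_of_mem _ (Finset.mem_univ i)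
  obtain ⟨j, _, hj⟩ := Finset.mem_biUnion.1 hi
  exact hcard.trans (hd' j _ hj)

/-- The functional `f` acts on a coordinate of the support of `x`. -/
def Meets (f x : C00) : Prop := ∃ i, f i ≠ 0 ∧ x i ≠ 0

lemma pairing_eq_zero_of_not_meets {f x : C00} (h : ¬ Meets f x) :
    Finsupp.linearCombination ℝ (⇑f) x = 0 := by
  refine pairing_eq_zero fun i hi => ?_
  by_contra h'
  exact h ⟨i, h', Finsupp.mem_support_iff.1 hi⟩

/-- A single coordinate lies in at most one block. -/
lemma exists_light_of_single {p : ℕ → ℕ+} (hp : StrictMono p) {y : ℕ → C00} (hy : IsBlock p y)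
    {f : C00} {m : ℕ+} (hf : ∀ i, f i ≠ 0 → i = m) (k : ℕ) :
    ∃ G ∈ light p (k + 1), ∀ n, n ∉ G → ¬ Meets f (y n) := by
  by_cases h : ∃ n, y n m ≠ 0
  · obtain ⟨n, hn⟩ := h
    refine ⟨{n}, singleton_mem_light p k n, fun l hl => ?_⟩
    rintro ⟨i, hi, hli⟩
    obtain rfl := hf i hi
    exact hl (Finset.mem_singleton.2 (eq_of_mem_block hp
      (hy l i (Finsupp.mem_support_iff.2 hli)) (hy n i (Finsupp.mem_support_iff.2 hn))))
  · push Not at h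
    refine ⟨∅, empty_mem_light p _, fun l _ => ?_⟩
    rintro ⟨i, hi, hli⟩
    obtain rfl := hf i hi
    exact hli (h l)

/-- Induction on the construction of `f`, for all `k` at once. Let `f = δ ∑ f_j`. If `y n` meets
only one `f_j`, then `f` acts on it as `δ f_j`, which gains a factor `δ` off the light set of `f_j`.
A block meeting several `f_j` is charged to one that is followed by another; each `j` is charged at
most once, so there are at most `d` such blocks. -/
lemma exists_light {δ : ℝ} (hδ0 : 0 < δ) (hδ1 : δ < 1) {p : ℕ → ℕ+} (hp : StrictMono p)
    {y : ℕ → C00} (hy : IsBlock p y) (hy1 : ∀ n, (tsirelson δ hδ0 hδ1).norm (y n) ≤ 1)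
    {f : C00} (hf : f ∈ (tsirelson δ hδ0 hδ1).carrier) :
    ∀ k, ∃ G ∈ light p k, ∀ n, n ∉ G → |Finsupp.linearCombination ℝ (⇑f) (y n)| ≤ δ ^ k := by
  classical
  have hzero : ∀ f ∈ (tsirelson δ hδ0 hδ1).carrier, ∃ G ∈ light p 0,
      ∀ n, n ∉ G → |Finsupp.linearCombination ℝ (⇑f) (y n)| ≤ δ ^ 0 := fun f hf =>
    ⟨∅, rfl, fun n _ => by
      rw [pow_zero]; exact (NormingSet.abs_pairing_le _ hf _).trans (hy1 n)⟩
  change Generated _ _ f at hf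
  induction hf with
  | pos m =>
    rintro (_ | k)
    · exact hzero _ (.pos m)
    · obtain ⟨G, hG, h⟩ := exists_light_of_single hp hy (f := Finsupp.single m 1) (m := m)
        (fun i hi => by
          by_contra h
          exact hi (Finsupp.single_eq_of_ne h)) k
      refine ⟨G, hG, fun n hn => ?_⟩
      rw [pairing_eq_zero_of_not_meets (h n hn), abs_zero]; positivity
  | neg m =>
    rintro (_ | k)
    · exact hzero _ (.neg m)
    · obtain ⟨G, hG, h⟩ := exists_light_of_single hp hy (f := -Finsupp.single m 1) (m := m)
        (fun i hi => by
          by_contra h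
          exact hi (by rw [Finsupp.neg_apply, Finsupp.single_eq_of_ne h, neg_zero])) k
      refine ⟨G, hG, fun n hn => ?_⟩
      rw [pairing_eq_zero_of_not_meets (h n hn), abs_zero]; positivity
  | sum u d hd f hf hP ih =>
    rintro (_ | k)
    · exact hzero _ (.sum u d hd f hf hP)
    · obtain ⟨hsucc, m, hm, hmem⟩ := hP
      choose B hB hBle using fun j => ih j k
      have hminj : Function.Injective m := minima_injective hsucc.disjoint fun i => (hm i).1
      have hdm : ∀ j, d ≤ (m j : ℕ) := le_of_mem_schreier_one hminj hmem
      -- `n` is split between `f j` and a later functional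
      let Q : ℕ → Fin d → Prop := fun n j => Meets (f j) (y n) ∧ ∃ l, j < l ∧ Meets (f l) (y n)
      -- If `j` were charged for `n < n'`, some later `f l` would meet the block of `n`, to the left
      -- of a point of `f j` in the block of `n'`, against `f j < f l`.
      have hQlt : ∀ n n' j, Q n j → Q n' j → ¬ n < n' := by
        rintro n n' j ⟨-, l, hjl, b, hb, hyb⟩ ⟨⟨a, ha, hya⟩, -⟩ hlt
        have h1 : a < b := hsucc j l hjl a (Finsupp.mem_support_iff.2 ha) b
          (Finsupp.mem_support_iff.2 hb)
        have h2 := (hy n b (Finsupp.mem_support_iff.2 hyb)).2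
        have h3 := (hy n' a (Finsupp.mem_support_iff.2 hya)).1
        have h4 : p (n + 1) ≤ p n' := hp.monotone hlt
        exact absurd (h1.trans (h2.trans_le (h4.trans h3))) (lt_irrefl _)
      have hQ : ∀ n n' j, Q n j → Q n' j → n = n' := fun n n' j h h' =>
        le_antisymm (not_lt.1 (hQlt n' n j h' h)) (not_lt.1 (hQlt n n' j h h'))
      -- The default `0` is harmless: it can only enlarge the exceptional set.
      let s : Fin d → ℕ := fun j => if h : ∃ n, Q n j then h.choose else 0
      have hs : ∀ n j, Q n j → s j = n := fun n j h => by
        have h' : ∃ n, Q n j := ⟨n, h⟩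
        simp only [s, dif_pos h']
        exact hQ _ _ j h'.choose_spec h
      -- Only blocks met by `f` are kept: such a block contains a point at or after some `m j ≥ d`,
      -- which gives `d ≤ p (n + 1)`. On the discarded blocks `f` vanishes.
      refine ⟨(Finset.univ.image s ∪ Finset.univ.biUnion B).filter
        fun n => ∃ j, Meets (f j) (y n), ⟨d, Finset.univ.image s, B, ?_, hB,
          Finset.filter_subset _ _, ?_⟩, ?_⟩
      · exact Finset.card_image_le.trans (by simp)
      · intro n hn
        obtain ⟨j, i, hi, hyi⟩ := (Finset.mem_filter.1 hn).2
        have h1 : m j ≤ i := (hm j).2 (Finsupp.mem_support_iff.2 hi)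
        have h2 := (hy n i (Finsupp.mem_support_iff.2 hyi)).2
        exact (hdm j).trans (PNat.coe_le_coe _ _ |>.2 (h1.trans h2.le))
      · intro n hn
        rw [pairing_smul_sum]
        by_cases hmeet : ∃ j, Meets (f j) (y n)
        · obtain ⟨j, hj⟩ := hmeet
          have hn' : n ∉ Finset.univ.image s ∪ Finset.univ.biUnion B := fun h =>
            hn (Finset.mem_filter.2 ⟨h, j, hj⟩)
          rw [Finset.mem_union, not_or] at hn'
          have hnQ : ∀ j, ¬ Q n j := fun j h =>
            hn'.1 (Finset.mem_image.2 ⟨j, Finset.mem_univ _, hs n j h⟩)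
          have huniq : ∀ l, l ≠ j → ¬ Meets (f l) (y n) := by
            intro l hl h
            rcases lt_or_gt_of_ne hl with h' | h'
            · exact hnQ l ⟨h, j, h', hj⟩
            · exact hnQ j ⟨hj, l, h', h⟩
          rw [Finset.sum_eq_single j
            (fun l _ hl => pairing_eq_zero_of_not_meets (huniq l hl)) (by simp),
            abs_mul, abs_of_pos hδ0, pow_succ']
          refine mul_le_mul_of_nonneg_left (hBle j n fun h => hn'.2 ?_) hδ0.le
          exact Finset.mem_biUnion.2 ⟨j, Finset.mem_univ _, h⟩
        · push Not at hmeet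
          rw [Finset.sum_eq_zero fun j _ => pairing_eq_zero_of_not_meets (hmeet j), mul_zero,
            abs_zero]
          positivity

/-- Off the light set each block contributes at most `a n * δ ^ k`; on it the trivial bound `1`
meets total weight at most `ε`. -/
lemma tsirelson_norm_sum_le {δ : ℝ} (hδ0 : 0 < δ) (hδ1 : δ < 1) {p : ℕ → ℕ+}
    (hp : StrictMono p) {y : ℕ → C00} (hy : IsBlock p y)
    (hy1 : ∀ n, (tsirelson δ hδ0 hδ1).norm (y n) ≤ 1) {k m : ℕ} {ε : ℝ} {F : Finset ℕ}
    {a : ℕ → ℝ} (h : IsSpread p k ε m F a) :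
    (tsirelson δ hδ0 hδ1).norm (∑ n ∈ F, a n • y n) ≤ δ ^ k + ε := by
  classical
  refine NormingSet.norm_le _ fun f hf => ?_
  obtain ⟨G, hG, hGle⟩ := exists_light hδ0 hδ1 hp hy hy1 hf k
  have hpt : ∀ n, a n * Finsupp.linearCombination ℝ (⇑f) (y n)
      ≤ a n * δ ^ k + if n ∈ G then a n else 0 := by
    intro n
    have ha := h.nonneg n
    have hk : 0 ≤ a n * δ ^ k := by positivity
    split_ifs with hn
    · have h1 : Finsupp.linearCombination ℝ (⇑f) (y n) ≤ 1 :=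
        (NormingSet.pairing_le _ hf _).trans (hy1 n)
      nlinarith
    · rw [add_zero]
      exact mul_le_mul_of_nonneg_left ((le_abs_self _).trans (hGle n hn)) ha
  calc Finsupp.linearCombination ℝ (⇑f) (∑ n ∈ F, a n • y n)
      = ∑ n ∈ F, a n * Finsupp.linearCombination ℝ (⇑f) (y n) := by
        rw [map_sum]; simp only [map_smul, smul_eq_mul]
    _ ≤ ∑ n ∈ F, (a n * δ ^ k + if n ∈ G then a n else 0) := Finset.sum_le_sum fun n _ => hpt n
    _ = δ ^ k + ∑ n ∈ F with n ∈ G, a n := by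
        rw [Finset.sum_add_distrib, ← Finset.sum_mul, h.sum_eq, one_mul, Finset.sum_filter]
    _ ≤ δ ^ k + ε := by
        gcongr
        refine le_trans ?_ (h.light_le G hG)
        exact Finset.sum_le_sum_of_subset_of_nonneg
          (fun n hn => (Finset.mem_filter.1 hn).2) fun n _ _ => h.nonneg n

/-! ### A gliding hump argument -/

/-- A normed space that contains `c₀₀` densely and on which the coordinates are continuous. -/
structure CoordSystem (X : Type) [NormedAddCommGroup X] [NormedSpace ℝ X] where
  emb : C00 →ₗ[ℝ] X
  dense : DenseRange emb
  coord : ℕ+ → X →L[ℝ] ℝ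
  coord_emb : ∀ n z, coord n (emb z) = z n

namespace CoordSystem

variable {X : Type} [NormedAddCommGroup X] [NormedSpace ℝ X] (D : CoordSystem X)

/-- Removing the coordinates below `N` is a continuous map `Q` that fixes `w` and preserves `c₀₀`.
Density gives `z` with `Q z` near `w`, and `Q z` is the required tail. -/
lemma exists_tail_near (N : ℕ+) {w : X} (hw : ∀ n < N, D.coord n w = 0) {ε : ℝ} (hε : 0 < ε) :
    ∃ z : C00, (∀ n ∈ z.support, N ≤ n) ∧ ‖D.emb z - w‖ < ε := by
  let Q : X → X := fun v => v - ∑ n ∈ Finset.Iio N, D.coord n v • D.emb (Finsupp.single n 1)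
  have hQ : Continuous Q := by fun_prop
  have hQw : Q w = w := by
    simp only [Q]
    rw [Finset.sum_eq_zero, sub_zero]
    intro n hn
    rw [hw n (Finset.mem_Iio.1 hn), zero_smul]
  have hopen : IsOpen (Q ⁻¹' Metric.ball w ε) := Metric.isOpen_ball.preimage hQ
  obtain ⟨z, hz⟩ := D.dense.exists_mem_open hopen ⟨w, by simp [hQw, hε]⟩
  refine ⟨z - ∑ n ∈ Finset.Iio N, z n • Finsupp.single n 1, fun n hn => ?_, ?_⟩
  · by_contra hlt
    rw [not_le] at hlt
    refine Finsupp.mem_support_iff.1 hn ?_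
    rw [Finsupp.sub_apply, Finsupp.finsetSum_apply, Finset.sum_eq_single_of_mem n
      (Finset.mem_Iio.2 hlt)]
    · simp
    · intro b _ hb
      simp [Finsupp.single_eq_of_ne hb.symm]
  · rw [Set.mem_preimage, mem_ball_iff_norm] at hz
    simpa only [Q, map_sub, map_sum, map_smul, D.coord_emb] using hz

end CoordSystem

lemma exists_ne_zero_of_forall_eq_zero {U : Type} [AddCommGroup U] [Module ℝ U]
    (hU : ¬ FiniteDimensional ℝ U) {ι : Type} [Finite ι] (φ : ι → U →ₗ[ℝ] ℝ) :
    ∃ u : U, u ≠ 0 ∧ ∀ i, φ i u = 0 := by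
  by_contra! h
  refine hU (FiniteDimensional.of_injective (LinearMap.pi φ) ?_)
  rw [← LinearMap.ker_eq_bot, LinearMap.ker_eq_bot']
  intro u hu
  by_contra h0
  obtain ⟨i, hi⟩ := h u h0
  exact hi (congrFun hu i)

section

variable {X Y : Type} [NormedAddCommGroup X] [NormedSpace ℝ X] [NormedAddCommGroup Y]
  [NormedSpace ℝ Y]

lemma exists_hump (D : CoordSystem X) (D' : CoordSystem Y) {U : Submodule ℝ X}
    {V : Submodule ℝ Y} (hU : ¬ FiniteDimensional ℝ U) (T : U ≃L[ℝ] V) (N : ℕ+) {ε : ℝ}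
    (hε : 0 < ε) : ∃ (w : U) (x z : C00) (M : ℕ+), ‖w‖ = 2 ∧
      (∀ n ∈ x.support, N ≤ n ∧ n < M) ∧ (∀ n ∈ z.support, N ≤ n ∧ n < M) ∧ N < M ∧
      ‖D.emb x - w‖ < ε ∧ ‖D'.emb z - T w‖ < ε := by
  -- Both `u` and `T u` must vanish below `N`, so that one interval serves for both approximations.
  obtain ⟨u, hu0, hu⟩ := exists_ne_zero_of_forall_eq_zero hU
    (ι := Finset.Iio N ⊕ Finset.Iio N) (Sum.elim
      (fun n => (D.coord n).toLinearMap ∘ₗ U.subtype)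
      (fun n => (D'.coord n).toLinearMap ∘ₗ V.subtype ∘ₗ T.toLinearEquiv.toLinearMap))
  have hu1 : ∀ n < N, D.coord n u = 0 := fun n hn => hu (Sum.inl ⟨n, Finset.mem_Iio.2 hn⟩)
  have hu2 : ∀ n < N, D'.coord n (T u) = 0 := fun n hn => hu (Sum.inr ⟨n, Finset.mem_Iio.2 hn⟩)
  have hun : ‖u‖ ≠ 0 := norm_ne_zero_iff.2 hu0
  set w : U := (2 / ‖u‖) • u with hw
  obtain ⟨x, hx, hxw⟩ := D.exists_tail_near N (w := w)
    (fun n hn => by rw [hw, Submodule.coe_smul, map_smul, hu1 n hn, smul_zero]) hε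
  obtain ⟨z, hz, hzw⟩ := D'.exists_tail_near N (w := T w)
    (fun n hn => by rw [hw, map_smul, Submodule.coe_smul, map_smul, hu2 n hn, smul_zero]) hε
  obtain ⟨M, hM⟩ := (insert N (x.support ∪ z.support)).bddAbove
  refine ⟨w, x, z, M + 1, ?_, fun n hn => ⟨hx n hn, ?_⟩, fun n hn => ⟨hz n hn, ?_⟩, ?_, hxw, hzw⟩
  · rw [hw, norm_smul, norm_div, norm_norm, Real.norm_two, div_mul_cancel₀ _ hun]
  all_goals
    refine PNat.lt_add_one_iff.2 (hM ?_)
    simp [*]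

lemma norm_sum_smul_sub_le {E : Type} [NormedAddCommGroup E] [NormedSpace ℝ E] {η : ℝ}
    (hη : 0 ≤ η) {F : Finset ℕ} {b : ℕ → ℝ} (hb : ∀ n ∈ F, |b n| ≤ 1) {u v : ℕ → E}
    (huv : ∀ n, ‖u n - v n‖ ≤ η * (1 / 2) ^ (n + 1)) :
    ‖∑ n ∈ F, b n • u n - ∑ n ∈ F, b n • v n‖ ≤ η := by
  rw [← Finset.sum_sub_distrib]
  calc ‖∑ n ∈ F, (b n • u n - b n • v n)‖ ≤ ∑ n ∈ F, η * (1 / 2) ^ (n + 1) := by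
        refine norm_sum_le_of_le _ fun n hn => ?_
        rw [← smul_sub, norm_smul, Real.norm_eq_abs]
        exact (mul_le_of_le_one_left (norm_nonneg _) (hb n hn)).trans (huv n)
    _ = (η / 2) * ∑ n ∈ F, (1 / 2) ^ n := by
        rw [Finset.mul_sum]
        exact Finset.sum_congr rfl fun n _ => by ring
    _ ≤ (η / 2) * 2 := by
        refine mul_le_mul_of_nonneg_left ?_ (by linarith)
        exact (summable_geometric_two.sum_le_tsum F fun n _ => by positivity).trans_eq
          tsum_geometric_two
    _ = η := by ring

/-- Total incomparability follows if no normalized block sequences of the two unit vector bases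
are equivalent, in a uniform way. -/
theorem totallyIncomparable_of_blocks (D : CoordSystem X) (D' : CoordSystem Y)
    (h : ∀ C : ℝ, 0 < C → ∃ c : ℝ, 0 < c ∧ ∀ (p : ℕ → ℕ+) (x y : ℕ → C00), StrictMono p →
      IsBlock p x → IsBlock p y → (∀ n, 1 ≤ ‖D.emb (x n)‖) → (∀ n, ‖D'.emb (y n)‖ ≤ 1) →
      ∃ (F : Finset ℕ) (b : ℕ → ℝ), (∀ n ∈ F, |b n| ≤ 1) ∧
        C * ‖D'.emb (∑ n ∈ F, b n • y n)‖ + c ≤ ‖D.emb (∑ n ∈ F, b n • x n)‖) :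
    TotallyIncomparable X Y := by
  intro U V _ _ hU
  refine ⟨fun T => ?_⟩
  obtain ⟨A, hA0, hA⟩ : ∃ A : ℝ, 0 < A ∧ ∀ u, ‖T u‖ ≤ A * ‖u‖ :=
    (T : U →L[ℝ] V).bound
  obtain ⟨B, hB0, hB⟩ : ∃ B : ℝ, 0 < B ∧ ∀ v, ‖T.symm v‖ ≤ B * ‖v‖ :=
    (T.symm : V →L[ℝ] U).bound
  -- Since `‖w‖ = 2`, the vectors `T w` have norm at most `2 * A`; the extra `1` covers the
  -- perturbation. The norm `2` likewise leaves `‖x‖ ≥ 1` after perturbation.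
  set R : ℝ := 2 * A + 1 with hR
  have hR0 : 0 < R := by positivity
  -- The gap `c` must not depend on the blocks: the precision `η` of the humps is fixed through it
  -- before they are built.
  obtain ⟨c, hc0, hc⟩ := h (B * R) (by positivity)
  set η : ℝ := min 1 (c / (2 * (1 + B))) with hη
  have hη0 : 0 < η := by positivity
  have hη1 : η ≤ 1 := min_le_left _ _
  have hηc : η * (1 + B) < c := by
    have h1 : η ≤ c / (2 * (1 + B)) := min_le_right _ _
    rw [le_div_iff₀ (by positivity)] at h1
    linarith
  choose w x z M hw hx hz hNM hxw hzw using fun (N : ℕ+) (n : ℕ) =>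
    exists_hump D D' hU T N (ε := η * (1 / 2) ^ (n + 1)) (by positivity)
  let p : ℕ → ℕ+ := fun n => Nat.rec 1 (fun n N => M N n) n
  have hp : StrictMono p := strictMono_nat_of_lt_succ fun n => hNM (p n) n
  have hη' : ∀ n : ℕ, η * (1 / 2) ^ (n + 1) ≤ 1 := fun n =>
    mul_le_one₀ hη1 (by positivity) (pow_le_one₀ (by norm_num) (by norm_num))
  obtain ⟨F, b, hb, hF⟩ := hc p (fun n => x (p n) n) (fun n => R⁻¹ • z (p n) n) hp
    (fun n i hi => hx (p n) n i hi)
    (fun n i hi => hz (p n) n i (Finsupp.support_smul hi))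
    (fun n => by
      have h1 := norm_sub_norm_le (w (p n) n : X) (D.emb (x (p n) n))
      rw [norm_sub_rev] at h1
      have h2 : ‖(w (p n) n : X)‖ = 2 := hw (p n) n
      linarith [hxw (p n) n, hη' n])
    (fun n => by
      have h1 := norm_sub_norm_le (D'.emb (z (p n) n)) (T (w (p n) n) : Y)
      have h2 : ‖(T (w (p n) n) : Y)‖ ≤ A * 2 := hw (p n) n ▸ hA (w (p n) n)
      rw [map_smul, norm_smul, norm_inv, Real.norm_of_nonneg hR0.le, inv_mul_le_iff₀ hR0]
      linarith [hzw (p n) n, hη' n])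
  set W : U := ∑ n ∈ F, b n • w (p n) n with hW
  have e1 : ‖D.emb (∑ n ∈ F, b n • x (p n) n) - W‖ ≤ η := by
    have := norm_sum_smul_sub_le hη0.le hb (u := fun n => D.emb (x (p n) n))
      (v := fun n => (w (p n) n : X)) fun n => (hxw (p n) n).le
    simpa [hW, map_sum, map_smul] using this
  have e2 : ‖D'.emb (∑ n ∈ F, b n • z (p n) n) - T W‖ ≤ η := by
    have := norm_sum_smul_sub_le hη0.le hb (u := fun n => D'.emb (z (p n) n))
      (v := fun n => (T (w (p n) n) : Y)) fun n => (hzw (p n) n).le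
    simpa [hW, map_sum, map_smul] using this
  have e3 : R * ‖D'.emb (∑ n ∈ F, b n • R⁻¹ • z (p n) n)‖
      = ‖D'.emb (∑ n ∈ F, b n • z (p n) n)‖ := by
    have : ∑ n ∈ F, b n • R⁻¹ • z (p n) n = R⁻¹ • ∑ n ∈ F, b n • z (p n) n := by
      rw [Finset.smul_sum]
      exact Finset.sum_congr rfl fun n _ => smul_comm _ _ _
    rw [this, map_smul, norm_smul, norm_inv, Real.norm_of_nonneg hR0.le,
      mul_inv_cancel_left₀ hR0.ne']
  have e4 : ‖(W : X)‖ ≤ B * ‖(T W : Y)‖ := by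
    have := hB (T W)
    rwa [T.symm_apply_apply] at this
  have e5 := norm_sub_norm_le (D.emb (∑ n ∈ F, b n • x (p n) n)) (W : X)
  have e6 := norm_sub_norm_le (T W : Y) (D'.emb (∑ n ∈ F, b n • z (p n) n))
  rw [norm_sub_rev] at e6
  rw [mul_assoc, e3] at hF
  have e7 : B * ‖(T W : Y)‖ ≤ B * (‖D'.emb (∑ n ∈ F, b n • z (p n) n)‖ + η) :=
    mul_le_mul_of_nonneg_left (by linarith) hB0.le
  -- By `e4` to `e7` the norm of the combination of the `x` is at most `B` times that of the `z`,
  -- plus `η * (1 + B) < c`, which contradicts `hF`.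
  nlinarith

end

/-! ### Coordinate functionals on completions. -/

/-- The completion of a normed space structure on `c₀₀` whose norm dominates the coordinates. -/
def CoordSystem.completion {E : Type} [NormedAddCommGroup E] [NormedSpace ℝ E] (e : C00 ≃ₗ[ℝ] E)
    (he : ∀ n z, |z n| ≤ ‖e z‖) : CoordSystem (UniformSpace.Completion E) where
  emb := (UniformSpace.Completion.toComplL : E →L[ℝ] _).toLinearMap ∘ₗ e.toLinearMap
  dense := by
    have := UniformSpace.Completion.denseRange_coe (α := E)
    exact this.comp e.surjective.denseRange (UniformSpace.Completion.continuous_coe E)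
  coord n := (LinearMap.mkContinuous (Finsupp.lapply n ∘ₗ e.symm.toLinearMap : E →ₗ[ℝ] ℝ) 1
    fun v => by simpa using he n (e.symm v)).extend UniformSpace.Completion.toComplL
  coord_emb n z := by
    have := ContinuousLinearMap.extend_eq (LinearMap.mkContinuous
      (Finsupp.lapply n ∘ₗ e.symm.toLinearMap : E →ₗ[ℝ] ℝ) 1
      fun v => by simpa using he n (e.symm v)) (e := UniformSpace.Completion.toComplL)
      UniformSpace.Completion.denseRange_coe
      (UniformSpace.Completion.isUniformInducing_coe E) (e z)
    refine this.trans ?_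
    simp

lemma CoordSystem.norm_completion_emb {E : Type} [NormedAddCommGroup E] [NormedSpace ℝ E]
    (e : C00 ≃ₗ[ℝ] E) (he : ∀ n z, |z n| ≤ ‖e z‖) (z : C00) :
    ‖(CoordSystem.completion e he).emb z‖ = ‖e z‖ :=
  UniformSpace.Completion.norm_coe (e z)

/-! ### Incomparability with the Tsirelson space -/

/-- The lower estimate `θ_k / 2` for convex combinations over `F_k`-admissible normalized
blocks. -/
def HasLowerEstimate (K : NormingSet) (θ : ℕ+ → ℝ) : Prop :=
  ∀ (p : ℕ → ℕ+) (x : ℕ → C00), StrictMono p → IsBlock p x → (∀ n, 1 ≤ K.norm (x n)) →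
    ∀ (k : ℕ+) (F : Finset ℕ) (a : ℕ → ℝ), F.image p ∈ schreier k → (∀ n, 0 ≤ a n) →
      ∑ n ∈ F, a n = 1 → θ k / 2 ≤ K.norm (∑ n ∈ F, a n • x n)

lemma hasLowerEstimate_modified (θ : ℕ+ → ℝ) (hθ : Regular θ) :
    HasLowerEstimate (modified θ hθ) θ := fun _ _ hp hx hx1 _ _ _ hF ha ha1 =>
  norm_sum_block_ge hθ.mem (fun _ _ _ h => h.1) (fun i => hereditary_allowable i)
    (fun _ _ _ h => h.allowable) hp hx hx1 hF ha ha1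

lemma hasLowerEstimate_boundedlyModified (m : ℕ+) (θ : ℕ+ → ℝ) (hθ : Regular θ) :
    HasLowerEstimate (boundedlyModified m θ hθ) θ := fun _ _ hp hx hx1 _ _ _ hF ha ha1 => by
  refine norm_sum_block_ge hθ.mem (fun _ _ _ h => h.elim (fun h => h.2.1) fun h => h.2.1.disjoint)
    (fun i => ?_) (fun i d E h => ?_) hp hx hx1 hF ha ha1
  · rintro d E d' E' e hne hsub (⟨hi, h⟩ | ⟨hi, h⟩)
    · exact Or.inl ⟨hi, hereditary_allowable i e hne hsub h⟩
    · exact Or.inr ⟨hi, hereditary_admissible i e hne hsub h⟩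
  · rcases le_or_gt i m with hi | hi
    · exact Or.inl ⟨hi, h.allowable⟩
    · exact Or.inr ⟨hi, h⟩

/-- For `δ < r < 1` eventually `r ^ (k + 1) < θ_{k+1}`, while `C * (δ / r) ^ k` drops below `r`. -/
lemma exists_mul_pow_lt {δ : ℝ} (hδ0 : 0 < δ) (hδ1 : δ < 1) {θ : ℕ+ → ℝ}
    (hθ : ∀ n, 0 < θ n)
    (hlim : Tendsto (fun n : ℕ+ => θ n ^ (1 / ((n : ℕ) : ℝ))) atTop (𝓝 1)) (C : ℝ) : ∃ k : ℕ, C * δ ^ k < θ k.succPNat := by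
  obtain ⟨r, hδr, hr1⟩ := exists_between hδ1
  have hr0 : 0 < r := hδ0.trans hδr
  have h1 : ∀ᶠ n : ℕ+ in atTop, r < θ n ^ (1 / ((n : ℕ) : ℝ)) := hlim.eventually_const_lt hr1
  obtain ⟨N, hN⟩ := eventually_atTop.1 h1
  have h2 : Tendsto (fun k : ℕ => C * (δ / r) ^ k) atTop (𝓝 (C * 0)) :=
    (tendsto_pow_atTop_nhds_zero_of_lt_one (by positivity)
      ((div_lt_one hr0).2 hδr)).const_mul C
  rw [mul_zero] at h2
  obtain ⟨k, hk, hkN⟩ := ((h2.eventually_lt_const hr0).and (eventually_ge_atTop (N : ℕ))).exists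
  refine ⟨k, ?_⟩
  have h3 := hN k.succPNat (PNat.coe_le_coe _ _ |>.1 (hkN.trans (Nat.le_succ k)))
  have h4 : r ^ (k + 1) < θ k.succPNat := by
    have h5 := pow_lt_pow_left₀ h3 hr0.le (Nat.succ_ne_zero k)
    rw [← Real.rpow_natCast (θ k.succPNat ^ _), ← Real.rpow_mul (hθ _).le,
      Nat.succPNat_coe, one_div_mul_cancel (by positivity), Real.rpow_one] at h5
    exact h5
  refine lt_trans ?_ h4
  rw [div_pow, mul_div_assoc', div_lt_iff₀ (by positivity)] at hk
  rwa [pow_succ']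

lemma exists_block_combination {δ : ℝ} (hδ0 : 0 < δ) (hδ1 : δ < 1) {K : NormingSet}
    {θ : ℕ+ → ℝ} (hK : HasLowerEstimate K θ) (k : ℕ) {p : ℕ → ℕ+} {x y : ℕ → C00}
    (hp : StrictMono p) (hx : IsBlock p x) (hy : IsBlock p y) (hx1 : ∀ n, 1 ≤ K.norm (x n))
    (hy1 : ∀ n, (tsirelson δ hδ0 hδ1).norm (y n) ≤ 1) :
    ∃ (F : Finset ℕ) (a : ℕ → ℝ), (∀ n, 0 ≤ a n) ∧ (∀ n, a n ≤ 1) ∧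
      θ k.succPNat / 2 ≤ K.norm (∑ n ∈ F, a n • x n) ∧
      (tsirelson δ hδ0 hδ1).norm (∑ n ∈ F, a n • y n) ≤ 2 * δ ^ k := by
  obtain ⟨F, a, h⟩ := exists_isSpread hp k (δ ^ k) (by positivity) 0
  refine ⟨F, a, h.nonneg, fun n => by simpa using h.sum_le_one {n},
    hK p x hp hx hx1 _ F a h.mem h.nonneg h.sum_eq, ?_⟩
  exact (tsirelson_norm_sum_le hδ0 hδ1 hp hy hy1 h).trans_eq (two_mul _).symm

/-- At each coordinate at most one block is nonzero, so squaring produces no cross terms. -/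
lemma sq_sum_sqrt_smul {p : ℕ → ℕ+} (hp : StrictMono p) {x : ℕ → C00} (hx : IsBlock p x)
    (F : Finset ℕ) {a : ℕ → ℝ} (ha : ∀ n, 0 ≤ a n) :
    sq (∑ n ∈ F, √(a n) • x n) = ∑ n ∈ F, a n • sq (x n) := by
  ext i
  simp only [NormingSet.sq_apply, Finsupp.finsetSum_apply, Finsupp.smul_apply, smul_eq_mul]
  by_cases h : ∃ n ∈ F, x n i ≠ 0
  · obtain ⟨n, hn, hni⟩ := h
    have hz : ∀ m ≠ n, x m i = 0 := fun m hm => by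
      by_contra h
      exact hm (eq_of_mem_block hp (hx m i (Finsupp.mem_support_iff.2 h))
        (hx n i (Finsupp.mem_support_iff.2 hni)))
    rw [Finset.sum_eq_single_of_mem n hn fun m _ hm => by rw [hz m hm, mul_zero],
      Finset.sum_eq_single_of_mem n hn fun m _ hm => by rw [hz m hm]; ring, mul_pow,
      Real.sq_sqrt (ha n)]
  · push Not at h
    rw [Finset.sum_eq_zero fun n hn => by rw [h n hn, mul_zero],
      Finset.sum_eq_zero fun n hn => by rw [h n hn]; ring]
    ring

/-- The unit vector basis of `K.Space`. -/
def NormingSet.coordSystem (K : NormingSet) : CoordSystem K.Space :=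
  CoordSystem.completion (E := K.Pre) (LinearEquiv.refl ℝ C00) fun n z => K.abs_apply_le z n

lemma NormingSet.norm_coordSystem_emb (K : NormingSet) (z : C00) :
    ‖K.coordSystem.emb z‖ = K.norm z :=
  CoordSystem.norm_completion_emb (E := K.Pre) (LinearEquiv.refl ℝ C00) _ z

/-- The unit vector basis of `K.Space2`. -/
def NormingSet.coordSystem2 (K : NormingSet) : CoordSystem K.Space2 :=
  CoordSystem.completion (E := K.Pre2) (LinearEquiv.refl ℝ C00) fun n z =>
    Real.abs_le_sqrt (by
      have := K.abs_apply_le (sq z) n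
      rw [NormingSet.sq_apply] at this
      exact (le_abs_self _).trans this)

lemma NormingSet.norm_coordSystem2_emb (K : NormingSet) (z : C00) :
    ‖K.coordSystem2.emb z‖ = √(K.norm (sq z)) :=
  CoordSystem.norm_completion_emb (E := K.Pre2) (LinearEquiv.refl ℝ C00) _ z

section

variable {δ : ℝ} (hδ0 : 0 < δ) (hδ1 : δ < 1) {K : NormingSet} {θ : ℕ+ → ℝ}

lemma totallyIncomparable_space (hK : HasLowerEstimate K θ) (hθ : ∀ n, 0 < θ n)
    (hlim : Tendsto (fun n : ℕ+ => θ n ^ (1 / ((n : ℕ) : ℝ))) atTop (𝓝 1)) :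
    TotallyIncomparable K.Space (tsirelson δ hδ0 hδ1).Space := by
  refine totallyIncomparable_of_blocks K.coordSystem (tsirelson δ hδ0 hδ1).coordSystem
    fun C hC => ?_
  -- The factor `8` gives `C * (2 * δ ^ k) < θ_{k+1} / 4`, half of the lower estimate.
  obtain ⟨k, hk⟩ := exists_mul_pow_lt hδ0 hδ1 hθ hlim (8 * C)
  refine ⟨θ k.succPNat / 4, by have := hθ k.succPNat; positivity,
    fun p x y hp hx hy hx1 hy1 => ?_⟩
  simp only [NormingSet.norm_coordSystem_emb] at hx1 hy1 ⊢
  obtain ⟨F, a, ha, ha1, hl, hu⟩ := exists_block_combination hδ0 hδ1 hK k hp hx hy hx1 hy1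
  refine ⟨F, a, fun n _ => by rw [abs_of_nonneg (ha n)]; exact ha1 n, ?_⟩
  have := mul_le_mul_of_nonneg_left hu hC.le
  linarith

lemma totallyIncomparable_space2 (hK : HasLowerEstimate K θ) (hθ : ∀ n, 0 < θ n)
    (hlim : Tendsto (fun n : ℕ+ => θ n ^ (1 / ((n : ℕ) : ℝ))) atTop (𝓝 1)) :
    TotallyIncomparable K.Space2 (tsirelson δ hδ0 hδ1).Space2 := by
  refine totallyIncomparable_of_blocks K.coordSystem2 (tsirelson δ hδ0 hδ1).coordSystem2
    fun C hC => ?_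
  -- The factor `16` gives `(2 * C) ^ 2 * (2 * δ ^ k) < θ_{k+1} / 2`; after taking roots, again half
  -- of the lower estimate is left.
  obtain ⟨k, hk⟩ := exists_mul_pow_lt hδ0 hδ1 hθ hlim (16 * C ^ 2)
  have hθk := hθ k.succPNat
  refine ⟨√(θ k.succPNat / 2) / 2, by positivity, fun p x y hp hx hy hx1 hy1 => ?_⟩
  simp only [NormingSet.norm_coordSystem2_emb] at hx1 hy1 ⊢
  obtain ⟨F, a, ha, ha1, hl, hu⟩ := exists_block_combination hδ0 hδ1 hK k hp
    (x := fun n => sq (x n)) (y := fun n => sq (y n))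
    (fun n i hi => hx n i (NormingSet.sq_support _ hi))
    (fun n i hi => hy n i (NormingSet.sq_support _ hi))
    (fun n => Real.one_le_sqrt.1 (hx1 n)) (fun n => by simpa using (Real.sqrt_le_iff.1 (hy1 n)).2)
  refine ⟨F, fun n => √(a n), fun n _ => ?_, ?_⟩
  · rw [abs_of_nonneg (Real.sqrt_nonneg _)]
    exact Real.sqrt_le_iff.2 ⟨zero_le_one, by simpa using ha1 n⟩
  · rw [sq_sum_sqrt_smul hp hx F ha, sq_sum_sqrt_smul hp hy F ha]
    have h1 : 2 * C * √((tsirelson δ hδ0 hδ1).norm (∑ n ∈ F, a n • sq (y n)))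
        ≤ √(θ k.succPNat / 2) := by
      refine Real.le_sqrt_of_sq_le ?_
      rw [mul_pow, Real.sq_sqrt (NormingSet.norm_nonneg _ _)]
      have := mul_le_mul_of_nonneg_left hu (sq_nonneg (2 * C))
      linarith
    have h2 := Real.sqrt_le_sqrt hl
    linarith

end

end MixedTsirelson

end

theorem proposition1p28 (δ : ℝ) (hδ0 : 0 < δ) (hδ1 : δ < 1)
    (θ : ℕ+ → ℝ) (hθ : MixedTsirelson.Regular θ)
    (hlim : Filter.Tendsto (fun n : ℕ+ => θ n ^ (1 / ((n : ℕ) : ℝ))) Filter.atTop (nhds 1)) :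
    (MixedTsirelson.TotallyIncomparable
        (MixedTsirelson.modified θ hθ).Space
        (MixedTsirelson.tsirelson δ hδ0 hδ1).Space ∧
      ∀ m : ℕ+, MixedTsirelson.TotallyIncomparable
        (MixedTsirelson.boundedlyModified m θ hθ).Space
        (MixedTsirelson.tsirelson δ hδ0 hδ1).Space) ∧
    (MixedTsirelson.TotallyIncomparable
        (MixedTsirelson.modified θ hθ).Space2
        (MixedTsirelson.tsirelson δ hδ0 hδ1).Space2 ∧
      ∀ m : ℕ+, MixedTsirelson.TotallyIncomparable
        (MixedTsirelson.boundedlyModified m θ hθ).Space2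
        (MixedTsirelson.tsirelson δ hδ0 hδ1).Space2) := by
  have h0 : ∀ n, 0 < θ n := fun n => (hθ.mem n).1
  have h1 := MixedTsirelson.hasLowerEstimate_modified θ hθ
  have h2 := fun m => MixedTsirelson.hasLowerEstimate_boundedlyModified m θ hθ
  exact ⟨⟨MixedTsirelson.totallyIncomparable_space hδ0 hδ1 h1 h0 hlim,
      fun m => MixedTsirelson.totallyIncomparable_space hδ0 hδ1 (h2 m) h0 hlim⟩,
    MixedTsirelson.totallyIncomparable_space2 hδ0 hδ1 h1 h0 hlim,
    fun m => MixedTsirelson.totallyIncomparable_space2 hδ0 hδ1 (h2 m) h0 hlim⟩
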